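/- Let $\sigma,\psi:\mathbb R\to\mathbb R$ be functions such that $\sigma$ is continuously differentiable, $\psi$ is differentiable, and $\sigma,\psi$ are $L$-Lipschitz with $\beta$-Lipschitz derivatives for some constants $L,\beta$. Let $\sigma_0,B\in\mathbb R$. Consider data $\mathbf x_1,\dots,\mathbf x_n\in\mathbb R^d$ with $\|\mathbf x_i\|_2\le B$ and encoded inputs $\mathbf x_1^{(e)},\dots,\mathbf x_n^{(e)}\in\mathbb R^d$ with $\|\mathbf x^{(e)}_i\|_2=1$. For weights $\theta=(\mathbf W^{(\mu)},\mathbf W^{(\sigma)},\mathbf W^{(d)})$, each in $\mathbb R^{m\times d}$, the stochastic network of width $m$ is $$\mathbf f(\mathbf x_i)=\frac1{\sqrt m}(\mathbf W^{(d)})^\top\psi(\sigma(\mathbf z_i)),\qquad \mathbf z_i=\mathbf W^{(\mu)}\mathbf x^{(e)}_i+(\mathbf W^{(\sigma)}\odot\boldsymbol\zeta)\mathbf x^{(e)}_i ,$$ where $\boldsymbol\zeta\in\mathbb R^{m\times d}$ has i.i.d. $\mathcal N(0,1)$ entries and $\sigma,\psi$ act coordinatewise. Its expected output is $\hat{\mathbf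 f}(\mathbf x_i)=\mathbb E_{\boldsymbol\zeta}[\mathbf f(\mathbf x_i)]$ and the loss is $L_{mse}=\frac1{2n}\sum_{i=1}^n\|\hat{\mathbf f}(\mathbf x_i)-\mathbf x_i\|_2^2$. At initialization the entries of $\mathbf W^{(\mu)}$ and $\mathbf W^{(d)}$ are i.i.d. $\mathcal N(0,1)$, and every entry of $\mathbf W^{(\sigma)}$ equals $\sigma_0$. The stochastic NTK is the $nd\times nd$ matrix $$\boldsymbol\Theta_{ik,jk'}=\sum_{s\in\{\mu,\sigma,d\}}\big\langle\nabla_{\mathbf W^{(s)}}\hat f_k(\mathbf x_i),\nabla_{\mathbf W^{(s)}}\hat f_{k'}(\mathbf x_j)\big\rangle ,$$ and $\boldsymbol\Theta^{\infty}$ denotes the entrywise limit in probability, as $m\to\infty$, of $\boldsymbol\Theta$ at initialization. Let $\lambda_0$ be the least eigenvalue of $\boldsymbol\Theta^\infty$. There is a constant $C>0$ depending only on $\sigma,\psi,\sigma_0,B$ (in particular not on $n$, $d$, the data, $\lambda_0$, $\delta$ or $m$) such that, if $\lambda_0>0$, $\delta\in(0,1)$ and $$m\ \ge\ C\max\Big\{\frac{n^5d^3}{\lambda_0^4\delta^2},\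 \frac{n^2d^2}{\lambda_0}\log\frac{nd}{\delta}\Big\},$$ then with probability at least $1-\delta$ over the random initialization $\theta(0)$, the gradient flow $\frac{d}{dt}\theta(t)=-\nabla_\theta L_{mse}(\theta(t))$ from $\theta(0)$ (on all three weight matrices) exists for all times and satisfies, for all $t\ge0$, $$L_{mse}(t)\le\exp\big(-(\lambda_0/n)\,t\big)\,L_{mse}(0).$$ -/

import Mathlib

open MeasureTheory ProbabilityTheory Filter Topology

namespace VAE

/-- The three trained weight matrices: `W^(μ)`, `W^(σ)` and `W^(d)`. -/
inductive Layer : Type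
  | mean
  | variance
  | decoder
  deriving DecidableEq

instance : Fintype Layer where
  elems := {Layer.mean, Layer.variance, Layer.decoder}
  complete := by intro s; cases s <;> simp

/-- All trainable weights of the width `m` network with input and output dimension `d`: three
`m × d` matrices, with the Euclidean (Frobenius) inner product. -/
abbrev Params (m d : ℕ) : Type := EuclideanSpace ℝ (Layer × Fin m × Fin d)

/-- The law of an `m × d` array of i.i.d. standard normal variables (the noise `ζ`). -/
noncomputable def noise (m d : ℕ) : Measure (Fin m × Fin d → ℝ) :=
  Measure.pi fun _ => gaussianReal 0 1

/-- The latent variable `z = W^(μ) x + (W^(σ) ⊙ ζ) x`, coordinate `r`. -/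
noncomputable def latent {m d : ℕ} (θ : Params m d) (ζ : Fin m × Fin d → ℝ)
    (xe : EuclideanSpace ℝ (Fin d)) (r : Fin m) : ℝ :=
  ∑ a, (θ (Layer.mean, r, a) + θ (Layer.variance, r, a) * ζ (r, a)) * xe a

/-- Output `k` of the stochastic network, `f = m^(-1/2) (W^(d))ᵀ ψ(σ(z))`, for noise `ζ`. -/
noncomputable def stochasticOutput (σ ψ : ℝ → ℝ) {m d : ℕ} (xe : EuclideanSpace ℝ (Fin d))
    (θ : Params m d) (ζ : Fin m × Fin d → ℝ) (k : Fin d) : ℝ :=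
  1 / √(m : ℝ) * ∑ r, θ (Layer.decoder, r, k) * ψ (σ (latent θ ζ xe r))

/-- The expected output: the expectation of output `k` over the noise. -/
noncomputable def expectedOutput (σ ψ : ℝ → ℝ) {m d : ℕ} (xe : EuclideanSpace ℝ (Fin d))
    (k : Fin d) (θ : Params m d) : ℝ :=
  ∫ ζ, stochasticOutput σ ψ xe θ ζ k ∂(noise m d)

/-- The loss `L_mse = 1/(2n) ∑ᵢ ‖E_ζ f(xᵢ) - xᵢ‖²`, as a function of the weights. -/
noncomputable def mseLoss (σ ψ : ℝ → ℝ) {n m d : ℕ} (x xe : Fin n → EuclideanSpace ℝ (Fin d))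
    (θ : Params m d) : ℝ :=
  1 / (2 * (n : ℝ)) * ∑ i, ∑ k, (expectedOutput σ ψ (xe i) k θ - x i k) ^ 2

/-- The tangent kernel of one weight matrix `W^(s)`, with entries
`⟨∇_{W^(s)} f̂_k(xᵢ), ∇_{W^(s)} f̂_k'(xⱼ)⟩`. -/
noncomputable def layerNTK (σ ψ : ℝ → ℝ) {n m d : ℕ} (xe : Fin n → EuclideanSpace ℝ (Fin d))
    (s : Layer) (θ : Params m d) : Matrix (Fin n × Fin d) (Fin n × Fin d) ℝ :=
  Matrix.of fun p q =>
    ∑ r : Fin m, ∑ a : Fin d,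
      gradient (expectedOutput (m := m) σ ψ (xe p.1) p.2) θ (s, r, a) *
        gradient (expectedOutput (m := m) σ ψ (xe q.1) q.2) θ (s, r, a)

/-- The stochastic neural tangent kernel of the whole network. -/
noncomputable def ntk (σ ψ : ℝ → ℝ) {n m d : ℕ} (xe : Fin n → EuclideanSpace ℝ (Fin d))
    (θ : Params m d) : Matrix (Fin n × Fin d) (Fin n × Fin d) ℝ :=
  layerNTK σ ψ xe Layer.mean θ + layerNTK σ ψ xe Layer.variance θ
    + layerNTK σ ψ xe Layer.decoder θ

/-- The law of one entry at initialization: `N(0,1)` for `W^(μ)` and `W^(d)`, and the constant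
`σ₀` for `W^(σ)`. -/
noncomputable def entryLaw (σ₀ : ℝ) : Layer → Measure ℝ
  | Layer.mean => gaussianReal 0 1
  | Layer.variance => Measure.dirac σ₀
  | Layer.decoder => gaussianReal 0 1

/-- The law of the random initialization: all entries independent. -/
noncomputable def initLaw (σ₀ : ℝ) (m d : ℕ) : Measure (Params m d) :=
  (Measure.pi fun p : Layer × Fin m × Fin d => entryLaw σ₀ p.1).map (WithLp.toLp 2)

/-- `Θinf` is the infinite-width limit of the tangent kernel at random initialization: every
entry converges in probability as the width tends to infinity. -/
def IsLimitingNTK (σ ψ : ℝ → ℝ) (σ₀ : ℝ) {n d : ℕ} (xe : Fin n → EuclideanSpace ℝ (Fin d))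
    (Θinf : Matrix (Fin n × Fin d) (Fin n × Fin d) ℝ) : Prop :=
  ∀ p q, ∀ ε : ℝ, 0 < ε →
    Tendsto (fun m : ℕ => initLaw σ₀ m d {θ | ε ≤ |ntk σ ψ xe θ p q - Θinf p q|}) atTop (𝓝 0)

/-- `lam` is the least eigenvalue of the matrix `A`. -/
def IsLeastEigenvalue {ι : Type*} [Fintype ι] [DecidableEq ι] (A : Matrix ι ι ℝ) (lam : ℝ) :
    Prop :=
  IsLeast {μ : ℝ | Module.End.HasEigenvalue (Matrix.toLin' A) μ} lam

/-- `θ` is a gradient flow of `F` on `[0, ∞)` started at `θ₀`. -/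
def IsGradientFlow {E : Type*} [NormedAddCommGroup E] [InnerProductSpace ℝ E] [CompleteSpace E]
    (F : E → ℝ) (θ₀ : E) (θ : ℝ → E) : Prop :=
  θ 0 = θ₀ ∧
    ∀ t : ℝ, 0 ≤ t → DifferentiableAt ℝ F (θ t) ∧
      HasDerivWithinAt θ (-gradient F (θ t)) (Set.Ici 0) t

end VAE

/-!
The composition `φ = ψ ∘ σ` is Lipschitz with Lipschitz derivative, and the expected output is
`f̂ₖ(xᵢ) = m^(-1/2) ∑ᵣ v_{rk} gᵢ(pᵣ)`, where `pᵣ` collects the weights of the hidden unit `r`,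
`v_{rk}` is its decoder weight, and `g(p) = E φ(⟪A, p⟫)` for the random vector `A = (x, ζ ⊙ x, 0)`
(`unitMean`, `features`). Integrating the Taylor bound of `φ` shows that `g` has a bounded and
Lipschitz gradient (`hasGradientAt_ridgeMean`). The tangent kernel is therefore an average over
hidden units, which are independent and identically distributed at initialization
(`ntk_eq_average`, `measurePreserving_rows`).

Randomness enters through three second moment estimates and Markov's inequality. At initialization
the loss is `O(d / δ)`, because the outputs are sums of centred independent terms
(`mseLoss_integral`); the tangent kernel is within `λ₀ / 4` of its limit in Frobenius norm
(`ntk_sq_distance`), the limit being the expectation of one summand by uniqueness of limits in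
probability (`IsLimitingNTK.eq_integral`); and the fourth powers of the norms of the decoder rows
sum to `O(m d² / δ)` (`decoderMoment_integral`).

The rest is deterministic. The loss satisfies `‖∇F‖² = n⁻² ‖Jᵀ u‖² ≥ (λ₀ / n) F` as long as the
Jacobian `J` stays close to its initial value (`mseLoss_PL`). This Polyak–Łojasiewicz inequality
bounds the length of the trajectory by `2 √(n F(θ₀) / λ₀)`, so that only a ball of radius
`R = O(√(n d / (δ λ₀)))` matters, on which `F` decays exponentially (`gradientFlow_of_PL`).
On this ball `J` moves little (`sum_norm_outputGrad_sub_sq_le`). The delicate term is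
`∑ᵣ ‖vᵣ‖² ‖∇g(pᵣ) - ∇g(qᵣ)‖²`: no uniform bound of the decoder rows is available without losing
factors, so `‖∇g(p) - ∇g(q)‖²` is bounded by a multiple of `‖p - q‖`, and the Cauchy–Schwarz
inequality gives `R` times the square root of the sum of the `‖vᵣ‖⁴`. This leads to
`m ≥ C n³ d³ / (δ² λ₀³)`, which follows from the assumption on the width because `λ₀` is bounded by
a constant (`width_bounds`).
-/

namespace VAE

/-! ### Gradient flow under a local Polyak–Łojasiewicz inequality -/

section GradientFlow

open Set Metric

variable {E : Type*} [NormedAddCommGroup E] [InnerProductSpace ℝ E] [CompleteSpace E]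

lemma hasDerivWithinAt_comp_of_hasGradientAt {F : E → ℝ} {g v : E} {θ : ℝ → E} {s : Set ℝ} {t : ℝ}
    (hF : HasGradientAt F g (θ t)) (hθ : HasDerivWithinAt θ v s t) :
    HasDerivWithinAt (fun u => F (θ u)) (inner ℝ g v) s t := by
  have h := hF.hasFDerivAt.comp_hasDerivWithinAt t hθ
  rwa [InnerProductSpace.toDual_apply_apply] at h

/-- Under the Polyak–Łojasiewicz inequality `c F ≤ ‖∇F‖²` along a trajectory of the negative
gradient, `F` decays exponentially and the trajectory has length at most `2 √(H / c)`. -/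
lemma gradientFlow_bounds_on_Icc {F : E → ℝ} {G : E → E} {θ : ℝ → E} {c H T : ℝ} (hc : 0 < c)
    (hH : 0 < H) (hT : 0 ≤ T) (hF0 : ∀ x, 0 ≤ F x) (hFH : F (θ 0) ≤ H)
    (hG : ∀ t ∈ Icc 0 T, HasGradientAt F (G (θ t)) (θ t))
    (hPL : ∀ t ∈ Icc 0 T, c * F (θ t) ≤ ‖G (θ t)‖ ^ 2)
    (hθ : ∀ t ∈ Icc 0 T, HasDerivWithinAt θ (-G (θ t)) (Ici 0) t) :
    F (θ T) ≤ Real.exp (-c * T) * F (θ 0) ∧ ‖θ T - θ 0‖ ≤ 2 * √(H / c) := by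
  have hθ' : ∀ t ∈ Icc 0 T, HasDerivWithinAt θ (-G (θ t)) (Ici t) t := fun t ht =>
    (hθ t ht).mono (Ici_subset_Ici.2 ht.1)
  have hcont : ContinuousOn θ (Icc 0 T) := fun t ht =>
    (hθ t ht).continuousWithinAt.mono Icc_subset_Ici_self
  have hFd : ∀ t ∈ Icc 0 T,
      HasDerivWithinAt (fun u => F (θ u)) (-‖G (θ t)‖ ^ 2) (Ici t) t := fun t ht => by
    have := hasDerivWithinAt_comp_of_hasGradientAt (hG t ht) (hθ' t ht)
    simpa [inner_neg_right] using this
  have hFc : ContinuousOn (fun u => F (θ u)) (Icc 0 T) := fun t ht =>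
    (hG t ht).continuousAt.comp_continuousWithinAt (hcont t ht)
  have hexp : ∀ a t : ℝ, HasDerivAt (fun u => Real.exp (a * u)) (a * Real.exp (a * t)) t := by
    intro a t
    have := ((hasDerivAt_id t).const_mul a).exp
    simpa [mul_comm] using this
  have hdecay : ∀ t ∈ Icc 0 T, F (θ t) * Real.exp (c * t) ≤ F (θ 0) := by
    intro t ht
    refine image_le_of_deriv_right_le_deriv_boundary (f := fun u => F (θ u) * Real.exp (c * u))
      (B := fun _ => F (θ 0)) (B' := fun _ => 0) ?_
      (fun x hx => (hFd x (Ico_subset_Icc_self hx)).mul (hexp c x).hasDerivWithinAt) (by simp)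
      continuousOn_const (fun x _ => hasDerivWithinAt_const ..) ?_ ht
    · exact hFc.mul (by fun_prop)
    · intro x hx
      have := hPL x (Ico_subset_Icc_self hx)
      have he := Real.exp_pos (c * x)
      nlinarith
  have hTT : T ∈ Icc 0 T := ⟨hT, le_rfl⟩
  constructor
  · have h := hdecay T hTT
    have he : Real.exp (-c * T) * Real.exp (c * T) = 1 := by
      rw [← Real.exp_add]; simp
    have := mul_le_mul_of_nonneg_left h (Real.exp_pos (-c * T)).le
    calc F (θ T) = F (θ T) * (Real.exp (-c * T) * Real.exp (c * T)) := by rw [he, mul_one]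
      _ = Real.exp (-c * T) * (F (θ T) * Real.exp (c * T)) := by ring
      _ ≤ _ := this
  -- By Young's inequality with the weight `exp (c t / 2) / A`, the speed `‖∇F‖` is dominated by
  -- the derivative of an explicit bounded function.
  set A := √(c * H) with hA
  have hA0 : 0 < A := Real.sqrt_pos.2 (by positivity)
  have hA2 : A ^ 2 = c * H := Real.sq_sqrt (by positivity)
  set e := fun u : ℝ => Real.exp (c / 2 * u)
  set e' := fun u : ℝ => Real.exp (-(c / 2) * u)
  set Bd := fun u : ℝ => (F (θ 0) - F (θ u) * e u) / (2 * A) + (H / (2 * A) + A / c) * (1 - e' u)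
  have hbound : ‖θ T - θ 0‖ ≤ Bd T := by
    refine image_norm_le_of_norm_deriv_right_le_deriv_boundary' (f := fun u => θ u - θ 0)
      (f' := fun u => -G (θ u)) (B := Bd) (hcont.sub continuousOn_const)
      (fun x hx => (hθ' x (Ico_subset_Icc_self hx)).sub_const _) (by simp [Bd, e, e']) ?_
      (fun x hx => ((((hFd x (Ico_subset_Icc_self hx)).mul
        (hexp (c / 2) x).hasDerivWithinAt).const_sub (F (θ 0))).div_const (2 * A)).add
        (((hexp (-(c / 2)) x).hasDerivWithinAt.const_sub 1).const_mul (H / (2 * A) + A / c)))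
      ?_ hTT
    · exact ((continuousOn_const.sub (hFc.mul (by fun_prop))).div_const _).add (by fun_prop)
    · intro x hx
      have hx' := Ico_subset_Icc_self hx
      have hd := hdecay x hx'
      have hex : Real.exp (c * x) = e x * e x := by
        simp only [e, ← Real.exp_add]; congr 1; ring
      have hee : e x * e' x = 1 := by simp [e, e', ← Real.exp_add]
      have hep : 0 < e x := Real.exp_pos _
      have hep' : 0 < e' x := Real.exp_pos _
      have hFe : F (θ x) * e x ≤ H * e' x := by
        have h1 : F (θ x) * (e x * e x) ≤ H := by rw [← hex]; linarith
        calc F (θ x) * e x = F (θ x) * (e x * e x) * e' x := by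
              rw [mul_assoc, mul_assoc, hee, mul_one]
          _ ≤ _ := mul_le_mul_of_nonneg_right h1 hep'.le
      have hy : 2 * A * ‖G (θ x)‖ ≤ ‖G (θ x)‖ ^ 2 * e x + A ^ 2 * e' x := by
        have h2 := mul_nonneg hep'.le (sq_nonneg (‖G (θ x)‖ * e x - A))
        have h3 : e' x * (‖G (θ x)‖ * e x - A) ^ 2 = ‖G (θ x)‖ ^ 2 * e x * (e x * e' x)
          - 2 * A * ‖G (θ x)‖ * (e x * e' x) + A ^ 2 * e' x := by ring
        rw [h3, hee] at h2
        linarith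
      have hk : (H / (2 * A) + A / c) * (c / 2 * e' x)
          = (c / 2 * (H * e' x) + A ^ 2 * e' x) / (2 * A) := by
        field_simp
      rw [norm_neg]
      change _ ≤ -(-‖G (θ x)‖ ^ 2 * e x + F (θ x) * (c / 2 * e x)) / (2 * A)
        + (H / (2 * A) + A / c) * -(-(c / 2) * e' x)
      rw [show -(-(c / 2) * e' x) = c / 2 * e' x by ring, hk, ← add_div,
        le_div_iff₀ (by positivity)]
      nlinarith
  refine hbound.trans ?_
  have h1 : Bd T ≤ H / (2 * A) + (H / (2 * A) + A / c) := by
    have h2 : (F (θ 0) - F (θ T) * e T) / (2 * A) ≤ H / (2 * A) := by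
      gcongr
      have := mul_nonneg (hF0 (θ T)) (Real.exp_pos (c / 2 * T)).le
      simp only [e]; linarith
    have h3 : (H / (2 * A) + A / c) * (1 - e' T) ≤ H / (2 * A) + A / c := by
      have : 0 ≤ H / (2 * A) + A / c := by positivity
      have : 0 < e' T := Real.exp_pos _
      nlinarith
    exact add_le_add h2 h3
  have h4 : √(H / c) = A / c := by
    rw [hA, show H / c = c * H / c ^ 2 by field_simp, Real.sqrt_div' _ (by positivity),
      Real.sqrt_sq hc.le]
  have h5 : H / A = A / c := by
    rw [div_eq_div_iff hA0.ne' hc.ne']; nlinarith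
  calc Bd T ≤ _ := h1
    _ = H / A + A / c := by field_simp; ring
    _ = 2 * √(H / c) := by rw [h5, h4]; ring

/-- If the Polyak–Łojasiewicz inequality holds on a ball whose radius exceeds the a priori bound
on the length of the trajectory, then a curve which follows `-∇F` inside the ball never leaves it,
and `F` decays exponentially along it. The vector field `V` is unconstrained outside the ball. -/
lemma mem_closedBall_and_decay_of_PL {F : E → ℝ} {G V : E → E} {θ : ℝ → E} {θ₀ : E} {c H R : ℝ}
    (hc : 0 < c) (hH : 0 < H) (hR : 2 * √(H / c) < R) (hF0 : ∀ x, 0 ≤ F x) (hFH : F θ₀ ≤ H)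
    (hG : ∀ x, HasGradientAt F (G x) x) (hPL : ∀ x ∈ closedBall θ₀ R, c * F x ≤ ‖G x‖ ^ 2)
    (hV : ∀ x ∈ closedBall θ₀ R, V x = -G x) (h0 : θ 0 = θ₀)
    (hθ : ∀ t, 0 ≤ t → HasDerivWithinAt θ (V (θ t)) (Ici 0) t) :
    ∀ t, 0 ≤ t → θ t ∈ closedBall θ₀ R ∧ F (θ t) ≤ Real.exp (-c * t) * F (θ 0) := by
  have key : ∀ T, 0 ≤ T → (∀ t ∈ Icc 0 T, θ t ∈ closedBall θ₀ R) →
      F (θ T) ≤ Real.exp (-c * T) * F (θ 0) ∧ ‖θ T - θ 0‖ ≤ 2 * √(H / c) := fun T hT hmem =>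
    gradientFlow_bounds_on_Icc hc hH hT hF0 (h0 ▸ hFH) (fun t _ => hG _)
      (fun t ht => hPL _ (hmem t ht)) (fun t ht => hV _ (hmem t ht) ▸ hθ t ht.1)
  have hcont : ContinuousOn (fun t => ‖θ t - θ 0‖) (Ici 0) := fun t ht =>
    (((hθ t ht).continuousWithinAt).sub continuousWithinAt_const).norm
  have hball : ∀ t, 0 ≤ t → θ t ∈ closedBall θ₀ R := by
    by_contra! hcon
    obtain ⟨t, ht, htR⟩ := hcon
    rw [mem_closedBall, dist_eq_norm, ← h0, not_le] at htR
    -- the first exit time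
    set S := Icc 0 t ∩ {s | R ≤ ‖θ s - θ 0‖}
    have hS : IsCompact S := by
      have : IsClosed S := (hcont.mono Icc_subset_Ici_self).preimage_isClosed_of_isClosed
        isClosed_Icc isClosed_Ici
      exact isCompact_Icc.of_isClosed_subset this inter_subset_left
    obtain ⟨s, hsS, hsmin⟩ := hS.exists_isLeast ⟨t, ⟨ht, le_rfl⟩, htR.le⟩
    have hlt : ∀ u ∈ Ico 0 s, ‖θ u - θ 0‖ < R := fun u hu => by
      by_contra! h
      exact absurd (hsmin ⟨⟨hu.1, hu.2.le.trans hsS.1.2⟩, h⟩) (not_le.2 hu.2)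
    have hs0 : 0 < s := by
      rcases hsS.1.1.eq_or_lt with h | h
      · have := hsS.2
        rw [← h] at this
        have h2 : (0 : ℝ) ≤ 2 * √(H / c) := by positivity
        simp at this
        linarith
      · exact h
    have hle : ∀ u ∈ Icc 0 s, ‖θ u - θ 0‖ ≤ R := by
      have : closure (Ico 0 s) = Icc 0 s := closure_Ico hs0.ne
      intro u hu
      exact ContinuousWithinAt.closure_le (this ▸ hu)
        ((hcont u hu.1).mono fun x hx => hx.1) continuousWithinAt_const (fun v hv => (hlt v hv).le)
    have := (key s hs0.le (fun u hu => by
      rw [mem_closedBall, dist_eq_norm, ← h0]; exact hle u hu)).2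
    exact absurd (this.trans_lt hR) (not_lt.2 hsS.2)
  exact fun t ht => ⟨hball t ht, (key t ht fun u hu => hball u hu.1).1⟩

/-- A bounded, globally Lipschitz vector field has integral curves defined on `[0, ∞)`. -/
lemma exists_integralCurve_of_lipschitz_of_bounded {V : E → E} {K : NNReal} {M : ℝ}
    (hV : LipschitzWith K V) (hM : ∀ x, ‖V x‖ ≤ M) (θ₀ : E) :
    ∃ θ : ℝ → E, θ 0 = θ₀ ∧ ∀ t, 0 ≤ t → HasDerivWithinAt θ (V (θ t)) (Ici 0) t := by
  have hM0 : 0 ≤ M := (norm_nonneg _).trans (hM θ₀)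
  have hloc : ∀ N : ℕ, ∃ α : ℝ → E, α 0 = θ₀ ∧
      ∀ t ∈ Icc (0 : ℝ) N, HasDerivWithinAt α (V (α t)) (Icc (0 : ℝ) N) t := by
    intro N
    have h0 : (0 : ℝ) ∈ Icc (0 : ℝ) N := ⟨le_rfl, N.cast_nonneg⟩
    have hP : IsPicardLindelof (fun _ => V) (⟨0, h0⟩ : Icc (0 : ℝ) N) θ₀
        (Real.toNNReal (M * N)) 0 (Real.toNNReal M) K :=
      .of_time_independent (fun x _ => by simpa [hM0] using hM x) hV.lipschitzOnWith
        (by simp [hM0, mul_nonneg])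
    exact hP.exists_eq_forall_mem_Icc_hasDerivWithinAt₀
  choose α hα0 hα using hloc
  have huniq : ∀ N N' : ℕ, N ≤ N' → EqOn (α N) (α N') (Icc (0 : ℝ) N) := by
    intro N N' hN
    have hsub : Icc (0 : ℝ) N ⊆ Icc (0 : ℝ) N' := Icc_subset_Icc_right (by exact_mod_cast hN)
    refine ODE_solution_unique (v := fun _ => V) (fun _ => hV)
      (fun t ht => (hα N t ht).continuousWithinAt) (fun t ht => ?_)
      (fun t ht => ((hα N' t (hsub ht)).mono hsub).continuousWithinAt) (fun t ht => ?_)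
      ((hα0 N).trans (hα0 N').symm)
    · exact (hα N t (Ico_subset_Icc_self ht)).mono_of_mem_nhdsWithin (Icc_mem_nhdsGE_of_mem ht)
    · exact ((hα N' t (hsub (Ico_subset_Icc_self ht))).mono hsub).mono_of_mem_nhdsWithin
        (Icc_mem_nhdsGE_of_mem ht)
  refine ⟨fun t => α (⌈t⌉₊ + 1) t, by simp [hα0], fun t ht => ?_⟩
  set N := ⌈t⌉₊ + 1
  have htN : t < N := (Nat.le_ceil t).trans_lt (by simp [N])
  have heq : ∀ s ∈ Icc (0 : ℝ) N, α (⌈s⌉₊ + 1) s = α N s := by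
    intro s hs
    rcases le_total (⌈s⌉₊ + 1) N with h | h
    · exact huniq _ _ h ⟨hs.1, (Nat.le_ceil s).trans (by push_cast; linarith)⟩
    · exact (huniq _ _ h hs).symm
  have h1 := (hα N t ⟨ht, htN.le⟩).congr heq (heq t ⟨ht, htN.le⟩)
  refine h1.mono_of_mem_nhdsWithin ?_
  exact mem_nhdsWithin.2 ⟨Iio N, isOpen_Iio, htN, fun x hx => ⟨hx.2, le_of_lt hx.1⟩⟩

end GradientFlow

section Clamp

open Metric

variable {ι : Type*} [Fintype ι]

/-- The nearest point retraction of Euclidean space onto the cube with centre `c` and half-side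
`R`. -/
noncomputable def clampCube (c : EuclideanSpace ℝ ι) (R : ℝ) (x : EuclideanSpace ℝ ι) :
    EuclideanSpace ℝ ι :=
  WithLp.toLp 2 fun i => max (c i - R) (min (c i + R) (x i))

lemma lipschitzWith_clampCube (c : EuclideanSpace ℝ ι) (R : ℝ) :
    LipschitzWith 1 (clampCube c R) := by
  refine LipschitzWith.of_dist_le_mul fun x y => ?_
  rw [NNReal.coe_one, one_mul, EuclideanSpace.dist_eq, EuclideanSpace.dist_eq]
  refine Real.sqrt_le_sqrt (Finset.sum_le_sum fun i _ => ?_)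
  rw [Real.dist_eq, Real.dist_eq]
  refine pow_le_pow_left₀ (abs_nonneg _) ?_ 2
  refine (abs_max_sub_max_le_max _ _ _ _).trans (max_le (by simp) ?_)
  exact (abs_min_sub_min_le_max _ _ _ _).trans (max_le (by simp) le_rfl)

lemma clampCube_eq_self {c x : EuclideanSpace ℝ ι} {R : ℝ} (hx : x ∈ closedBall c R) :
    clampCube c R x = x := by
  ext i
  have h : |x i - c i| ≤ R := by
    have := PiLp.norm_apply_le (x - c) i
    rw [mem_closedBall, dist_eq_norm] at hx
    simpa using this.trans hx
  rw [abs_le] at h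
  simp only [clampCube]
  rw [min_eq_right (by linarith), max_eq_right (by linarith)]

lemma clampCube_mem_closedBall (c x : EuclideanSpace ℝ ι) {R : ℝ} (hR : 0 ≤ R) :
    clampCube c R x ∈ closedBall c (√(Fintype.card ι * R ^ 2)) := by
  rw [mem_closedBall, EuclideanSpace.dist_eq]
  refine Real.sqrt_le_sqrt ?_
  calc ∑ i, dist (clampCube c R x i) (c i) ^ 2 ≤ ∑ _i : ι, R ^ 2 := by
        refine Finset.sum_le_sum fun i _ => pow_le_pow_left₀ dist_nonneg ?_ 2
        rw [Real.dist_eq, abs_le]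
        simp only [clampCube]
        constructor
        · linarith [le_max_left (c i - R) (min (c i + R) (x i))]
        · have : max (c i - R) (min (c i + R) (x i)) ≤ c i + R :=
            max_le (by linarith) (min_le_left _ _)
          linarith
    _ = _ := by simp

/-- Linear convergence of gradient flow under a local Polyak–Łojasiewicz inequality: existence for
all times, and exponential decay along every gradient flow. -/
theorem gradientFlow_of_PL {F : EuclideanSpace ℝ ι → ℝ}
    {G : EuclideanSpace ℝ ι → EuclideanSpace ℝ ι} {θ₀ : EuclideanSpace ℝ ι} {c H R : ℝ}
    (hc : 0 < c) (hH : 0 < H) (hR : 2 * √(H / c) < R) (hF0 : ∀ x, 0 ≤ F x) (hFH : F θ₀ ≤ H)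
    (hG : ∀ x, HasGradientAt F (G x) x) (hGL : LocallyLipschitz G)
    (hPL : ∀ x ∈ closedBall θ₀ R, c * F x ≤ ‖G x‖ ^ 2) :
    (∃ θ : ℝ → EuclideanSpace ℝ ι, IsGradientFlow F θ₀ θ) ∧
      ∀ θ : ℝ → EuclideanSpace ℝ ι, IsGradientFlow F θ₀ θ → ∀ t : ℝ, 0 ≤ t →
        F (θ t) ≤ Real.exp (-c * t) * F (θ 0) := by
  have hR0 : 0 ≤ R := (by positivity : (0 : ℝ) ≤ 2 * √(H / c)).trans hR.le
  constructor
  · set Q := closedBall θ₀ (√(Fintype.card ι * R ^ 2))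
    have hQ : IsCompact Q := isCompact_closedBall _ _
    obtain ⟨K, hK⟩ := (hGL.locallyLipschitzOn (s := Q)).exists_lipschitzOnWith_of_compact hQ
    obtain ⟨M, hM⟩ := hQ.exists_bound_of_continuousOn hGL.continuous.continuousOn
    have hL : LipschitzWith (K * 1) fun x => -G (clampCube θ₀ R x) := by
      refine LipschitzWith.neg ?_
      rw [← lipschitzOnWith_univ]
      exact hK.comp (lipschitzWith_clampCube θ₀ R).lipschitzOnWith
        fun x _ => clampCube_mem_closedBall θ₀ x hR0
    obtain ⟨θ, h0, hθ⟩ := exists_integralCurve_of_lipschitz_of_bounded hL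
      (fun x => by rw [norm_neg]; exact hM _ (clampCube_mem_closedBall θ₀ x hR0)) θ₀
    have hmem := mem_closedBall_and_decay_of_PL hc hH hR hF0 hFH hG hPL
      (V := fun x => -G (clampCube θ₀ R x)) (fun x hx => by rw [clampCube_eq_self hx]) h0 hθ
    refine ⟨θ, h0, fun t ht => ⟨(hG _).differentiableAt, ?_⟩⟩
    have := hθ t ht
    rwa [clampCube_eq_self (hmem t ht).1, ← (hG (θ t)).gradient] at this
  · intro θ hθ t ht
    refine (mem_closedBall_and_decay_of_PL hc hH hR hF0 hFH hG hPL (V := fun x => -G x)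
      (fun _ _ => rfl) hθ.1 (fun s hs => ?_) t ht).2
    have := (hθ.2 s hs).2
    rwa [(hG (θ s)).gradient] at this

end Clamp

/-! ### Averages of ridge functions -/

section RidgeMean

/-- `φ` is differentiable with derivative `φ'`, which is bounded by `L` and `β`-Lipschitz. -/
structure IsSmoothActivation (φ φ' : ℝ → ℝ) (L β : ℝ) : Prop where
  hasDerivAt : ∀ u, HasDerivAt φ (φ' u) u
  abs_deriv_le : ∀ u, |φ' u| ≤ L
  abs_deriv_sub_le : ∀ u v, |φ' u - φ' v| ≤ β * |u - v|

namespace IsSmoothActivation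

variable {φ φ' : ℝ → ℝ} {L β : ℝ}

lemma L_nonneg (h : IsSmoothActivation φ φ' L β) : 0 ≤ L := (abs_nonneg _).trans (h.abs_deriv_le 0)

lemma β_nonneg (h : IsSmoothActivation φ φ' L β) : 0 ≤ β := by
  simpa using (abs_nonneg _).trans (h.abs_deriv_sub_le 1 0)

lemma continuous (h : IsSmoothActivation φ φ' L β) : Continuous φ :=
  continuous_iff_continuousAt.2 fun u => (h.hasDerivAt u).continuousAt

lemma continuous_deriv (h : IsSmoothActivation φ φ' L β) : Continuous φ' :=
  (LipschitzWith.of_dist_le_mul (K := β.toNNReal) fun u v => by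
    rw [Real.coe_toNNReal _ h.β_nonneg, Real.dist_eq, Real.dist_eq]
    exact h.abs_deriv_sub_le u v).continuous

lemma abs_sub_le (h : IsSmoothActivation φ φ' L β) (u v : ℝ) : |φ u - φ v| ≤ L * |u - v| := by
  have := convex_univ.norm_image_sub_le_of_norm_hasDerivWithin_le (f := φ) (f' := φ') (C := L)
    (fun x _ => (h.hasDerivAt x).hasDerivWithinAt) (fun x _ => h.abs_deriv_le x)
    (Set.mem_univ v) (Set.mem_univ u)
  simpa using this

lemma abs_le (h : IsSmoothActivation φ φ' L β) (u : ℝ) : |φ u| ≤ |φ 0| + L * |u| := by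
  have := h.abs_sub_le u 0
  rw [sub_zero] at this
  linarith [abs_sub_abs_le_abs_sub (φ u) (φ 0)]

lemma abs_taylor_le (h : IsSmoothActivation φ φ' L β)
    (u v : ℝ) : |φ v - φ u - φ' u * (v - u)| ≤ β * (v - u) ^ 2 := by
  have := (convex_uIcc u v).norm_image_sub_le_of_norm_hasDerivWithin_le
    (f := fun x => φ x - φ' u * x) (f' := fun x => φ' x - φ' u * 1) (C := β * |v - u|)
    (fun x _ => ((h.hasDerivAt x).sub ((hasDerivAt_id x).const_mul _)).hasDerivWithinAt)
    (fun x hx => by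
      rw [mul_one]
      refine (h.abs_deriv_sub_le x u).trans ?_
      exact mul_le_mul_of_nonneg_left (Set.abs_sub_left_of_mem_uIcc hx) h.β_nonneg)
    (Set.left_mem_uIcc) (Set.right_mem_uIcc)
  calc |φ v - φ u - φ' u * (v - u)| = ‖φ v - φ' u * v - (φ u - φ' u * u)‖ := by
        rw [Real.norm_eq_abs]; congr 1; ring
    _ ≤ _ := this
    _ = _ := by rw [Real.norm_eq_abs, mul_assoc, abs_mul_abs_self]; ring

end IsSmoothActivation

variable {Ω H : Type*} [MeasurableSpace Ω] [NormedAddCommGroup H] [InnerProductSpace ℝ H]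

/-- The average `p ↦ E φ(⟪A, p⟫)` of a ridge function over a random direction `A`. -/
noncomputable def ridgeMean (μ : Measure Ω) (A : Ω → H) (φ : ℝ → ℝ) (p : H) : ℝ :=
  ∫ ω, φ (inner ℝ (A ω) p) ∂μ

/-- The vector `E φ'(⟪A, p⟫) A`, which is the gradient of `ridgeMean μ A φ` if `φ'` is the
derivative of `φ`. -/
noncomputable def ridgeMeanGrad (μ : Measure Ω) (A : Ω → H) (φ' : ℝ → ℝ) (p : H) : H :=
  ∫ ω, φ' (inner ℝ (A ω) p) • A ω ∂μ

variable {μ : Measure Ω} [IsProbabilityMeasure μ] {A : Ω → H} {φ φ' : ℝ → ℝ} {L β : ℝ}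

lemma integrable_ridge (h : IsSmoothActivation φ φ' L β) (hA : MemLp A 2 μ) (p : H) :
    Integrable (fun ω => φ (inner ℝ (A ω) p)) μ := by
  have hA1 : Integrable A μ := hA.integrable (by norm_num)
  refine Integrable.mono' (g := fun ω => |φ 0| + L * (‖A ω‖ * ‖p‖)) ?_ ?_ ?_
  · exact (integrable_const _).add ((hA1.norm.mul_const _).const_mul _)
  · exact h.continuous.comp_aestronglyMeasurable
      (hA1.aestronglyMeasurable.inner aestronglyMeasurable_const)
  · refine Eventually.of_forall fun ω => (h.abs_le _).trans ?_
    gcongr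
    · exact h.L_nonneg
    · exact abs_real_inner_le_norm _ _

lemma integrable_ridgeGrad (h : IsSmoothActivation φ φ' L β) (hA : MemLp A 2 μ) (p : H) :
    Integrable (fun ω => φ' (inner ℝ (A ω) p) • A ω) μ := by
  have hA1 : Integrable A μ := hA.integrable (by norm_num)
  refine hA1.bdd_smul (C := L) ?_ (Eventually.of_forall fun ω => h.abs_deriv_le _)
  exact h.continuous_deriv.comp_aestronglyMeasurable
      (hA1.aestronglyMeasurable.inner aestronglyMeasurable_const)

lemma norm_ridgeMeanGrad_le (h : IsSmoothActivation φ φ' L β) (hA : MemLp A 2 μ) (p : H) :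
    ‖ridgeMeanGrad μ A φ' p‖ ≤ L * ∫ ω, ‖A ω‖ ∂μ := by
  have hA1 : Integrable A μ := hA.integrable (by norm_num)
  rw [← integral_const_mul]
  refine norm_integral_le_of_norm_le (hA1.norm.const_mul L) (Eventually.of_forall fun ω => ?_)
  rw [norm_smul]
  exact mul_le_mul_of_nonneg_right (h.abs_deriv_le _) (norm_nonneg _)

lemma norm_ridgeMeanGrad_sub_le (h : IsSmoothActivation φ φ' L β) (hA : MemLp A 2 μ) (p q : H) :
    ‖ridgeMeanGrad μ A φ' p - ridgeMeanGrad μ A φ' q‖ ≤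
      β * (∫ ω, ‖A ω‖ ^ 2 ∂μ) * ‖p - q‖ := by
  rw [ridgeMeanGrad, ridgeMeanGrad,
    ← integral_sub (integrable_ridgeGrad h hA p) (integrable_ridgeGrad h hA q)]
  rw [show β * (∫ ω, ‖A ω‖ ^ 2 ∂μ) * ‖p - q‖ = ∫ ω, ‖A ω‖ ^ 2 * (β * ‖p - q‖) ∂μ by
    rw [integral_mul_const]; ring]
  refine norm_integral_le_of_norm_le ((hA.integrable_norm_pow (by norm_num)).mul_const _)
    (Eventually.of_forall fun ω => ?_)
  rw [← sub_smul, norm_smul]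
  calc ‖φ' (inner ℝ (A ω) p) - φ' (inner ℝ (A ω) q)‖ * ‖A ω‖
      ≤ β * (‖A ω‖ * ‖p - q‖) * ‖A ω‖ := by
        refine mul_le_mul_of_nonneg_right ((h.abs_deriv_sub_le _ _).trans ?_) (norm_nonneg _)
        refine mul_le_mul_of_nonneg_left ?_ h.β_nonneg
        rw [← inner_sub_right]
        exact abs_real_inner_le_norm _ _
    _ = _ := by ring

lemma abs_ridgeMean_sub_le (h : IsSmoothActivation φ φ' L β) (hA : MemLp A 2 μ) (p q : H) :
    |ridgeMean μ A φ p - ridgeMean μ A φ q| ≤ L * (∫ ω, ‖A ω‖ ∂μ) * ‖p - q‖ := by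
  have hA1 : Integrable A μ := hA.integrable (by norm_num)
  rw [ridgeMean, ridgeMean, ← integral_sub (integrable_ridge h hA p) (integrable_ridge h hA q)]
  rw [show L * (∫ ω, ‖A ω‖ ∂μ) * ‖p - q‖ = ∫ ω, ‖A ω‖ * (L * ‖p - q‖) ∂μ by
    rw [integral_mul_const]; ring]
  rw [← Real.norm_eq_abs]
  refine norm_integral_le_of_norm_le (hA1.norm.mul_const (L * ‖p - q‖))
    (Eventually.of_forall fun ω => ?_)
  calc ‖φ (inner ℝ (A ω) p) - φ (inner ℝ (A ω) q)‖
      ≤ L * (‖A ω‖ * ‖p - q‖) := by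
        refine (h.abs_sub_le _ _).trans (mul_le_mul_of_nonneg_left ?_ h.L_nonneg)
        rw [← inner_sub_right]
        exact abs_real_inner_le_norm _ _
    _ = _ := by ring

/-- The second order Taylor bound of `φ` is integrated against the law of `A`, which only needs
the second moment of `A`. -/
lemma hasGradientAt_ridgeMean [CompleteSpace H] (h : IsSmoothActivation φ φ' L β) (hA : MemLp A 2 μ)
    (p : H) : HasGradientAt (ridgeMean μ A φ) (ridgeMeanGrad μ A φ' p) p := by
  rw [hasGradientAt_iff_isLittleO]
  have hO : (fun q => ridgeMean μ A φ q - ridgeMean μ A φ p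
      - inner ℝ (ridgeMeanGrad μ A φ' p) (q - p)) =O[𝓝 p] fun q => ‖q - p‖ ^ 2 := by
    refine Asymptotics.IsBigO.of_bound (β * ∫ ω, ‖A ω‖ ^ 2 ∂μ) (Eventually.of_forall fun q => ?_)
    have hi : inner ℝ (ridgeMeanGrad μ A φ' p) (q - p)
        = ∫ ω, φ' (inner ℝ (A ω) p) * inner ℝ (A ω) (q - p) ∂μ := by
      rw [real_inner_comm, ridgeMeanGrad, ← integral_inner (integrable_ridgeGrad h hA p)]
      refine integral_congr_ae (Eventually.of_forall fun ω => ?_)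
      simp only [inner_smul_right, real_inner_comm]
    have hint : Integrable (fun ω => φ' (inner ℝ (A ω) p) * inner ℝ (A ω) (q - p)) μ := by
      refine ((integrable_ridgeGrad h hA p).inner_const (q - p)).congr
        (Eventually.of_forall fun ω => ?_)
      simp only [real_inner_smul_left]
    have hd : Integrable (fun ω => φ (inner ℝ (A ω) q) - φ (inner ℝ (A ω) p)) μ :=
      (integrable_ridge h hA q).sub (integrable_ridge h hA p)
    rw [hi, ridgeMean, ridgeMean, ← integral_sub (integrable_ridge h hA q)
      (integrable_ridge h hA p), ← integral_sub hd hint]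
    rw [show β * (∫ ω, ‖A ω‖ ^ 2 ∂μ) * ‖‖q - p‖ ^ 2‖
        = ∫ ω, ‖A ω‖ ^ 2 * (β * ‖q - p‖ ^ 2) ∂μ by
      rw [integral_mul_const, Real.norm_of_nonneg (by positivity)]; ring]
    refine norm_integral_le_of_norm_le ((hA.integrable_norm_pow (by norm_num)).mul_const _)
      (Eventually.of_forall fun ω => ?_)
    have ht := h.abs_taylor_le (inner ℝ (A ω) p) (inner ℝ (A ω) q)
    rw [← inner_sub_right] at ht
    refine ht.trans ?_
    have hcs : (inner ℝ (A ω) (q - p)) ^ 2 ≤ (‖A ω‖ * ‖q - p‖) ^ 2 := by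
      rw [← sq_abs]
      exact pow_le_pow_left₀ (abs_nonneg _) (abs_real_inner_le_norm _ _) 2
    calc β * (inner ℝ (A ω) (q - p)) ^ 2 ≤ β * (‖A ω‖ * ‖q - p‖) ^ 2 :=
          mul_le_mul_of_nonneg_left hcs h.β_nonneg
      _ = _ := by ring
  refine hO.trans_isLittleO ?_
  simp_rw [pow_two]
  have h1 : (fun q : H => ‖q - p‖) =o[𝓝 p] fun _ => (1 : ℝ) := by
    rw [Asymptotics.isLittleO_one_iff]
    have : Continuous fun q : H => ‖q - p‖ := by fun_prop
    simpa using this.tendsto p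
  have h2 : (fun q : H => ‖q - p‖) =O[𝓝 p] fun q => q - p := Asymptotics.isBigO_norm_left.2
    (Asymptotics.isBigO_refl _ _)
  simpa using (h1.mul_isBigO h2.norm_right).norm_right

end RidgeMean

/-! ### The expected network as a sum over hidden units -/

lemma sum_layer {M : Type*} [AddCommMonoid M] (f : Layer → M) :
    ∑ s, f s = f .mean + f .variance + f .decoder := by
  change ∑ s ∈ {Layer.mean, Layer.variance, Layer.decoder}, f s = _
  rw [Finset.sum_insert (by decide), Finset.sum_insert (by decide), Finset.sum_singleton,
    add_assoc]

/-- The weights attached to one hidden unit: one row of each of the three weight matrices. -/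
abbrev Row (d : ℕ) : Type := EuclideanSpace ℝ (Layer × Fin d)

/-- The weights of the hidden unit `r`. -/
noncomputable def row {m d : ℕ} (r : Fin m) : Params m d →L[ℝ] Row d :=
  LinearMap.toContinuousLinearMap
    { toFun := fun θ => WithLp.toLp 2 fun p => θ (p.1, r, p.2)
      map_add' := fun _ _ => rfl
      map_smul' := fun _ _ => rfl }

@[simp]
lemma row_apply {m d : ℕ} (r : Fin m) (θ : Params m d) (p : Layer × Fin d) :
    row r θ p = θ (p.1, r, p.2) := rfl

lemma inner_eq_sum_inner_row {m d : ℕ} (u v : Params m d) :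
    inner ℝ u v = ∑ r, inner ℝ (row r u) (row r v) := by
  simp only [PiLp.inner_apply, Fintype.sum_prod_type, row_apply]
  exact Finset.sum_comm

lemma norm_sq_eq_sum_row {m d : ℕ} (u : Params m d) : ‖u‖ ^ 2 = ∑ r, ‖row r u‖ ^ 2 := by
  simp only [← real_inner_self_eq_norm_sq]
  exact inner_eq_sum_inner_row u u

/-- The random vector `(x, ζ ⊙ x, 0)`, whose inner product with the weights of a unit is the
latent variable of the unit. -/
noncomputable def features {d : ℕ} (xe : EuclideanSpace ℝ (Fin d)) (ζ : Fin d → ℝ) : Row d :=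
  WithLp.toLp 2 fun p => match p.1 with
    | .mean => xe p.2
    | .variance => ζ p.2 * xe p.2
    | .decoder => 0

/-- The law of the noise seen by one hidden unit. -/
noncomputable abbrev unitNoise (d : ℕ) : Measure (Fin d → ℝ) :=
  Measure.pi fun _ => gaussianReal 0 1

lemma inner_features {d : ℕ} (xe : EuclideanSpace ℝ (Fin d)) (ζ : Fin d → ℝ) (p : Row d) :
    inner ℝ (features xe ζ) p
      = ∑ a, p (.mean, a) * xe a + ∑ a, p (.variance, a) * ζ a * xe a := by
  simp only [PiLp.inner_apply, Fintype.sum_prod_type, sum_layer, features, RCLike.inner_apply,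
    conj_trivial, mul_zero, Finset.sum_const_zero, add_zero, mul_assoc]

lemma norm_sq_features {d : ℕ} (xe : EuclideanSpace ℝ (Fin d)) (ζ : Fin d → ℝ) :
    ‖features xe ζ‖ ^ 2 = ‖xe‖ ^ 2 + ∑ a, ζ a ^ 2 * xe a ^ 2 := by
  simp only [EuclideanSpace.real_norm_sq_eq, Fintype.sum_prod_type, sum_layer, features,
    mul_pow, zero_pow two_ne_zero, Finset.sum_const_zero, add_zero]

lemma measurable_features {d : ℕ} (xe : EuclideanSpace ℝ (Fin d)) : Measurable (features xe) := by
  refine (WithLp.measurable_toLp 2 _).comp (measurable_pi_iff.2 fun p => ?_)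
  rcases p with ⟨_ | _ | _, a⟩ <;> simp only <;> fun_prop

lemma integrable_sq_gaussian : Integrable (fun z : ℝ => z ^ 2) (gaussianReal 0 1) :=
  (memLp_id_gaussianReal 2).integrable_sq

lemma integral_sq_gaussian : ∫ z : ℝ, z ^ 2 ∂gaussianReal 0 1 = 1 := by
  have h := variance_of_integral_eq_zero (μ := gaussianReal 0 1) (X := id) (by fun_prop)
    (by simp)
  rw [variance_id_gaussianReal] at h
  simpa using h.symm

lemma memLp_features {d : ℕ} (xe : EuclideanSpace ℝ (Fin d)) :
    MemLp (features xe) 2 (unitNoise d) := by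
  rw [memLp_two_iff_integrable_sq_norm (measurable_features xe).aestronglyMeasurable]
  simp only [norm_sq_features]
  refine (integrable_const _).add (integrable_finsetSum _ fun a _ => Integrable.mul_const ?_ _)
  exact integrable_comp_eval (i := a) (μ := fun _ : Fin d => gaussianReal 0 1)
    (f := fun z : ℝ => z ^ 2) integrable_sq_gaussian

lemma integral_norm_sq_features {d : ℕ} {xe : EuclideanSpace ℝ (Fin d)} (hx : ‖xe‖ = 1) :
    ∫ ζ, ‖features xe ζ‖ ^ 2 ∂unitNoise d = 2 := by
  simp only [norm_sq_features]
  have hi : ∀ a : Fin d, Integrable (fun ζ : Fin d → ℝ => ζ a ^ 2) (unitNoise d) := fun a =>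
    integrable_comp_eval (i := a) (μ := fun _ : Fin d => gaussianReal 0 1)
    (f := fun z : ℝ => z ^ 2) integrable_sq_gaussian
  rw [integral_add (integrable_const _) (integrable_finsetSum _ fun a _ => (hi a).mul_const _),
    integral_finsetSum _ fun a _ => (hi a).mul_const _]
  have he : ∀ a : Fin d, ∫ ζ : Fin d → ℝ, ζ a ^ 2 ∂unitNoise d = 1 := fun a => by
    rw [integral_comp_eval (i := a) (μ := fun _ : Fin d => gaussianReal 0 1)
      (f := fun z : ℝ => z ^ 2) integrable_sq_gaussian.aestronglyMeasurable, integral_sq_gaussian]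
  simp only [integral_mul_const, he, one_mul, ← EuclideanSpace.real_norm_sq_eq, hx]
  norm_num

lemma integral_norm_features_le {d : ℕ} {xe : EuclideanSpace ℝ (Fin d)} (hx : ‖xe‖ = 1) :
    ∫ ζ, ‖features xe ζ‖ ∂unitNoise d ≤ 2 := by
  have h2 := (memLp_features xe).integrable_norm_pow (by norm_num)
  calc ∫ ζ, ‖features xe ζ‖ ∂unitNoise d ≤ ∫ ζ, (1 + ‖features xe ζ‖ ^ 2) / 2 ∂unitNoise d := by
        refine integral_mono ((memLp_features xe).integrable (by norm_num)).norm
          (((integrable_const _).add h2).div_const _) fun ζ => ?_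
        have := sq_nonneg (‖features xe ζ‖ - 1)
        simp only; linarith
    _ ≤ 2 := by
        rw [integral_div, integral_add (integrable_const _) h2, integral_norm_sq_features hx]
        norm_num

/-- The expected activation `E φ(z)` of a hidden unit, as a function of the weights of the unit. -/
noncomputable def unitMean {d : ℕ} (φ : ℝ → ℝ) (xe : EuclideanSpace ℝ (Fin d)) : Row d → ℝ :=
  ridgeMean (unitNoise d) (features xe) φ

/-- The gradient of `unitMean φ xe`, if `φ'` is the derivative of `φ`. -/
noncomputable def unitMeanGrad {d : ℕ} (φ' : ℝ → ℝ) (xe : EuclideanSpace ℝ (Fin d)) :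
    Row d → Row d :=
  ridgeMeanGrad (unitNoise d) (features xe) φ'

/-- The contribution of one hidden unit to `√m` times the output coordinate `k`. -/
noncomputable def neuron {d : ℕ} (φ : ℝ → ℝ) (xe : EuclideanSpace ℝ (Fin d)) (k : Fin d)
    (p : Row d) : ℝ :=
  p (.decoder, k) * unitMean φ xe p

/-- The gradient of `neuron φ xe k`, if `φ'` is the derivative of `φ`. -/
noncomputable def neuronGrad {d : ℕ} (φ φ' : ℝ → ℝ) (xe : EuclideanSpace ℝ (Fin d)) (k : Fin d)
    (p : Row d) : Row d :=
  p (.decoder, k) • unitMeanGrad φ' xe p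
    + unitMean φ xe p • EuclideanSpace.single (.decoder, k) 1

section

variable {d : ℕ} {φ φ' : ℝ → ℝ} {L β : ℝ} {xe : EuclideanSpace ℝ (Fin d)}

lemma norm_unitMeanGrad_le (h : IsSmoothActivation φ φ' L β) (hx : ‖xe‖ = 1) (p : Row d) :
    ‖unitMeanGrad φ' xe p‖ ≤ 2 * L := by
  refine (norm_ridgeMeanGrad_le h (memLp_features xe) p).trans ?_
  rw [mul_comm 2]
  exact mul_le_mul_of_nonneg_left (integral_norm_features_le hx) h.L_nonneg

lemma norm_unitMeanGrad_sub_le (h : IsSmoothActivation φ φ' L β) (hx : ‖xe‖ = 1) (p q : Row d) :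
    ‖unitMeanGrad φ' xe p - unitMeanGrad φ' xe q‖ ≤ 2 * β * ‖p - q‖ := by
  have := norm_ridgeMeanGrad_sub_le h (memLp_features xe) p q
  rw [integral_norm_sq_features hx, mul_comm β] at this
  exact this

lemma abs_unitMean_sub_le (h : IsSmoothActivation φ φ' L β) (hx : ‖xe‖ = 1) (p q : Row d) :
    |unitMean φ xe p - unitMean φ xe q| ≤ 2 * L * ‖p - q‖ := by
  refine (abs_ridgeMean_sub_le h (memLp_features xe) p q).trans ?_
  rw [mul_comm 2]
  exact mul_le_mul_of_nonneg_right
    (mul_le_mul_of_nonneg_left (integral_norm_features_le hx) h.L_nonneg) (norm_nonneg _)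

lemma hasGradientAt_neuron (h : IsSmoothActivation φ φ' L β) (k : Fin d) (p : Row d) :
    HasGradientAt (neuron φ xe k) (neuronGrad φ φ' xe k p) p := by
  have h1 := (EuclideanSpace.proj (Layer.decoder, k) : Row d →L[ℝ] ℝ).hasFDerivAt (x := p)
  have h2 := h1.mul (hasGradientAt_ridgeMean h (memLp_features xe) p).hasFDerivAt
  rw [hasGradientAt_iff_hasFDerivAt]
  refine h2.congr_fderiv ?_
  ext v
  simp [neuronGrad, unitMean, unitMeanGrad, EuclideanSpace.inner_single_left]

lemma locallyLipschitz_mul {X : Type*} [PseudoEMetricSpace X] {f g : X → ℝ}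
    (hf : LocallyLipschitz f) (hg : LocallyLipschitz g) : LocallyLipschitz fun x => f x * g x :=
  (ContDiff.locallyLipschitz (f := fun z : ℝ × ℝ => z.1 * z.2) (𝕂 := ℝ) (by fun_prop)).comp
    (hf.prodMk hg)

lemma locallyLipschitz_sum {X ι : Type*} [PseudoEMetricSpace X] {F : Type*}
    [SeminormedAddCommGroup F] {f : ι → X → F} (s : Finset ι)
    (hf : ∀ i, LocallyLipschitz (f i)) : LocallyLipschitz fun x => ∑ i ∈ s, f i x := by
  classical
  induction s using Finset.induction_on with
  | empty => simpa using LocallyLipschitz.const (0 : F)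
  | insert a s ha ih => simpa [Finset.sum_insert ha] using (hf a).add ih

lemma locallyLipschitz_euclidean {X ι : Type*} [PseudoEMetricSpace X] [Fintype ι]
    {f : X → EuclideanSpace ℝ ι} (hf : ∀ i, LocallyLipschitz fun x => f x i) :
    LocallyLipschitz f := by
  classical
  have h : f = fun x => ∑ i, EuclideanSpace.single i (f x i) := by
    ext x i; simp [Finset.sum_apply, Pi.single_apply]
  rw [h]
  refine locallyLipschitz_sum _ fun i => ?_
  refine LocallyLipschitz.comp (f := fun t : ℝ => EuclideanSpace.single i t) ?_ (hf i)
  exact (LipschitzWith.of_dist_le_mul (K := 1) fun a b => by simp).locallyLipschitz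

lemma locallyLipschitz_apply {ι : Type*} [Fintype ι] (i : ι) :
    LocallyLipschitz fun x : EuclideanSpace ℝ ι => x i :=
  (EuclideanSpace.proj i : EuclideanSpace ℝ ι →L[ℝ] ℝ).lipschitz.locallyLipschitz

lemma locallyLipschitz_unitMean (h : IsSmoothActivation φ φ' L β) (hx : ‖xe‖ = 1) :
    LocallyLipschitz (unitMean φ xe) :=
  (LipschitzWith.of_dist_le' fun p q => by
    rw [dist_eq_norm, dist_eq_norm]; exact abs_unitMean_sub_le h hx p q).locallyLipschitz

lemma locallyLipschitz_unitMeanGrad (h : IsSmoothActivation φ φ' L β) (hx : ‖xe‖ = 1) :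
    LocallyLipschitz (unitMeanGrad φ' xe) :=
  (LipschitzWith.of_dist_le' fun p q => by
    rw [dist_eq_norm, dist_eq_norm]; exact norm_unitMeanGrad_sub_le h hx p q).locallyLipschitz

lemma locallyLipschitz_neuron (h : IsSmoothActivation φ φ' L β) (hx : ‖xe‖ = 1) (k : Fin d) :
    LocallyLipschitz (neuron φ xe k) :=
  locallyLipschitz_mul (locallyLipschitz_apply _) (locallyLipschitz_unitMean h hx)

lemma locallyLipschitz_neuronGrad (h : IsSmoothActivation φ φ' L β) (hx : ‖xe‖ = 1) (k : Fin d) :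
    LocallyLipschitz (neuronGrad φ φ' xe k) := by
  refine locallyLipschitz_euclidean fun i => ?_
  simp only [neuronGrad, PiLp.add_apply, PiLp.smul_apply, smul_eq_mul]
  refine (locallyLipschitz_mul (locallyLipschitz_apply _) ?_).add
    (locallyLipschitz_mul (locallyLipschitz_unitMean h hx) (LocallyLipschitz.const _))
  exact (locallyLipschitz_apply i).comp (locallyLipschitz_unitMeanGrad h hx)

end

/-- The gradient of the expected output coordinate `k`, assembled from the gradients of the
units. -/
noncomputable def outputGrad {m d : ℕ} (φ φ' : ℝ → ℝ) (xe : EuclideanSpace ℝ (Fin d)) (k : Fin d)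
    (θ : Params m d) : Params m d :=
  WithLp.toLp 2 fun i => 1 / √(m : ℝ) * neuronGrad φ φ' xe k (row i.2.1 θ) (i.1, i.2.2)

lemma row_outputGrad {m d : ℕ} (φ φ' : ℝ → ℝ) (xe : EuclideanSpace ℝ (Fin d)) (k : Fin d)
    (θ : Params m d) (r : Fin m) :
    row r (outputGrad φ φ' xe k θ) = (1 / √(m : ℝ)) • neuronGrad φ φ' xe k (row r θ) := rfl

/-- A subfamily of independent coordinates is again a product measure. -/
lemma pi_map_injective {ι κ : Type*} [Fintype ι] [Fintype κ] {X : ι → Type*}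
    [∀ i, MeasurableSpace (X i)] (μ : ∀ i, Measure (X i)) [∀ i, IsProbabilityMeasure (μ i)]
    {e : κ → ι} (he : Function.Injective e) :
    (Measure.pi μ).map (fun ω j => ω (e j)) = Measure.pi fun j => μ (e j) := by
  have h : iIndepFun (fun i (ω : ∀ i, X i) => ω i) (Measure.pi μ) :=
    iIndepFun_pi (X := fun i (x : X i) => x) fun i => aemeasurable_id
  have h2 := h.precomp he
  rw [iIndepFun_iff_map_fun_eq_pi_map fun i => (measurable_pi_apply _).aemeasurable] at h2
  rw [h2]
  congr with j : 1
  exact (measurePreserving_eval μ (e j)).map_eq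

lemma measurePreserving_noise_row {m d : ℕ} (r : Fin m) :
    MeasurePreserving (fun (ζ : Fin m × Fin d → ℝ) a => ζ (r, a)) (noise m d) (unitNoise d) where
  measurable := by fun_prop
  map_eq := pi_map_injective (fun _ => gaussianReal 0 1) (Prod.mk_right_injective r)

section

variable {m d : ℕ} {φ φ' : ℝ → ℝ} {L β : ℝ}

lemma latent_eq_inner (θ : Params m d) (ζ : Fin m × Fin d → ℝ) (xe : EuclideanSpace ℝ (Fin d))
    (r : Fin m) : latent θ ζ xe r = inner ℝ (features xe fun a => ζ (r, a)) (row r θ) := by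
  rw [inner_features, latent, ← Finset.sum_add_distrib]
  exact Finset.sum_congr rfl fun a _ => by simp [add_mul]

lemma expectedOutput_eq {σ ψ : ℝ → ℝ} (h : IsSmoothActivation (fun u => ψ (σ u)) φ' L β)
    (xe : EuclideanSpace ℝ (Fin d)) (k : Fin d) (θ : Params m d) :
    expectedOutput σ ψ xe k θ
      = 1 / √(m : ℝ) * ∑ r, neuron (fun u => ψ (σ u)) xe k (row r θ) := by
  simp only [expectedOutput, stochasticOutput, latent_eq_inner]
  have hr : ∀ r : Fin m, Integrable (fun ζ : Fin m × Fin d → ℝ =>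
      ψ (σ (inner ℝ (features xe fun a => ζ (r, a)) (row r θ)))) (noise m d) := fun r =>
    (measurePreserving_noise_row r).integrable_comp_of_integrable
      (integrable_ridge h (memLp_features xe) (row r θ))
  rw [integral_const_mul, integral_finsetSum _ fun r _ => (hr r).const_mul _]
  congr 1
  refine Finset.sum_congr rfl fun r _ => ?_
  rw [integral_const_mul, neuron, unitMean, ridgeMean, ← (measurePreserving_noise_row r).map_eq,
    integral_map (measurePreserving_noise_row r).measurable.aemeasurable]
  · rfl
  · rw [(measurePreserving_noise_row r).map_eq]
    exact (integrable_ridge h (memLp_features xe) (row r θ)).aestronglyMeasurable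

lemma hasGradientAt_expectedOutput {σ ψ : ℝ → ℝ}
    (h : IsSmoothActivation (fun u => ψ (σ u)) φ' L β) (xe : EuclideanSpace ℝ (Fin d)) (k : Fin d)
    (θ : Params m d) :
    HasGradientAt (expectedOutput (m := m) σ ψ xe k)
      (outputGrad (fun u => ψ (σ u)) φ' xe k θ) θ := by
  rw [show expectedOutput (m := m) σ ψ xe k = _ from funext (expectedOutput_eq h xe k),
    hasGradientAt_iff_hasFDerivAt]
  have h1 : ∀ r : Fin m, HasFDerivAt (fun θ => neuron (fun u => ψ (σ u)) xe k (row r θ)) _ θ :=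
    fun r => (hasGradientAt_neuron (xe := xe) h k (row r θ)).hasFDerivAt.comp θ (row r).hasFDerivAt
  refine ((HasFDerivAt.fun_sum fun r _ => h1 r).const_mul (1 / √(m : ℝ))).congr_fderiv ?_
  ext v
  rw [InnerProductSpace.toDual_apply_apply, inner_eq_sum_inner_row]
  simp only [row_outputGrad, real_inner_smul_left, ← Finset.mul_sum]
  simp

lemma ntk_eq_inner {n : ℕ} {σ ψ : ℝ → ℝ} (h : IsSmoothActivation (fun u => ψ (σ u)) φ' L β)
    (xe : Fin n → EuclideanSpace ℝ (Fin d)) (θ : Params m d) (p q : Fin n × Fin d) :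
    ntk σ ψ xe θ p q = inner ℝ (outputGrad (fun u => ψ (σ u)) φ' (xe p.1) p.2 θ)
      (outputGrad (fun u => ψ (σ u)) φ' (xe q.1) q.2 θ) := by
  simp only [ntk, layerNTK, Matrix.add_apply, Matrix.of_apply, PiLp.inner_apply,
    Fintype.sum_prod_type, sum_layer, (hasGradientAt_expectedOutput h _ _ θ).gradient,
    RCLike.inner_apply, conj_trivial, mul_comm]

lemma ntk_eq_average {n : ℕ} {σ ψ : ℝ → ℝ} (h : IsSmoothActivation (fun u => ψ (σ u)) φ' L β)
    (xe : Fin n → EuclideanSpace ℝ (Fin d)) (θ : Params m d) (p q : Fin n × Fin d) :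
    ntk σ ψ xe θ p q = 1 / (m : ℝ) * ∑ r,
      inner ℝ (neuronGrad (fun u => ψ (σ u)) φ' (xe p.1) p.2 (row r θ))
        (neuronGrad (fun u => ψ (σ u)) φ' (xe q.1) q.2 (row r θ)) := by
  rw [ntk_eq_inner h, inner_eq_sum_inner_row]
  simp only [row_outputGrad, real_inner_smul_left, real_inner_smul_right, ← Finset.mul_sum,
    ← mul_assoc]
  congr 1
  rw [div_mul_div_comm, one_mul, Real.mul_self_sqrt m.cast_nonneg]

lemma locallyLipschitz_outputGrad (h : IsSmoothActivation φ φ' L β)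
    {xe : EuclideanSpace ℝ (Fin d)} (hx : ‖xe‖ = 1) (k : Fin d) :
    LocallyLipschitz (outputGrad (m := m) φ φ' xe k) := by
  refine locallyLipschitz_euclidean fun i => ?_
  refine locallyLipschitz_mul (LocallyLipschitz.const _) ?_
  exact (locallyLipschitz_apply _).comp
    ((locallyLipschitz_neuronGrad h hx k).comp (row i.2.1).lipschitz.locallyLipschitz)

lemma locallyLipschitz_expectedOutput {σ ψ : ℝ → ℝ}
    (h : IsSmoothActivation (fun u => ψ (σ u)) φ' L β) {xe : EuclideanSpace ℝ (Fin d)}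
    (hx : ‖xe‖ = 1) (k : Fin d) : LocallyLipschitz (expectedOutput (m := m) σ ψ xe k) := by
  rw [show expectedOutput (m := m) σ ψ xe k = _ from funext (expectedOutput_eq h xe k)]
  refine locallyLipschitz_mul (LocallyLipschitz.const _) (locallyLipschitz_sum _ fun r => ?_)
  exact (locallyLipschitz_neuron h hx k).comp (row r).lipschitz.locallyLipschitz

/-- The gradient `(1 / n) Jᵀ (f̂ - x)` of the loss. -/
noncomputable def lossGrad {n : ℕ} (σ ψ φ' : ℝ → ℝ) (x xe : Fin n → EuclideanSpace ℝ (Fin d))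
    (θ : Params m d) : Params m d :=
  (1 / (n : ℝ)) • ∑ i, ∑ k, (expectedOutput σ ψ (xe i) k θ - x i k) •
    outputGrad (fun u => ψ (σ u)) φ' (xe i) k θ

lemma hasGradientAt_mseLoss {n : ℕ} {σ ψ : ℝ → ℝ}
    (h : IsSmoothActivation (fun u => ψ (σ u)) φ' L β)
    (x xe : Fin n → EuclideanSpace ℝ (Fin d)) (θ : Params m d) :
    HasGradientAt (mseLoss (m := m) σ ψ x xe) (lossGrad σ ψ φ' x xe θ) θ := by
  rw [hasGradientAt_iff_hasFDerivAt]
  have h1 : ∀ i k, HasFDerivAt (fun θ : Params m d => (expectedOutput σ ψ (xe i) k θ - x i k) ^ 2)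
      _ θ := fun i k => ((hasGradientAt_expectedOutput h (xe i) k θ).hasFDerivAt.sub_const _).pow 2
  refine ((HasFDerivAt.fun_sum fun i _ => HasFDerivAt.fun_sum fun k _ => h1 i k).const_mul
    (1 / (2 * (n : ℝ)))).congr_fderiv ?_
  ext v
  simp only [lossGrad, InnerProductSpace.toDual_apply_apply, real_inner_smul_left, sum_inner,
    smul_apply, sum_apply, smul_eq_mul, Finset.mul_sum]
  refine Finset.sum_congr rfl fun i _ => Finset.sum_congr rfl fun k _ => ?_
  push_cast
  field_simp
  ring

lemma locallyLipschitz_lossGrad {n : ℕ} {σ ψ : ℝ → ℝ}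
    (h : IsSmoothActivation (fun u => ψ (σ u)) φ' L β)
    (x : Fin n → EuclideanSpace ℝ (Fin d)) {xe : Fin n → EuclideanSpace ℝ (Fin d)}
    (hx : ∀ i, ‖xe i‖ = 1) : LocallyLipschitz (lossGrad (m := m) σ ψ φ' x xe) := by
  refine locallyLipschitz_euclidean fun j => ?_
  simp only [lossGrad, PiLp.smul_apply, WithLp.ofLp_sum, Finset.sum_apply, smul_eq_mul]
  refine locallyLipschitz_mul (LocallyLipschitz.const _) (locallyLipschitz_sum _ fun i =>
    locallyLipschitz_sum _ fun k => locallyLipschitz_mul ?_ ?_)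
  · simp only [sub_eq_add_neg]
    exact (locallyLipschitz_expectedOutput h (hx i) k).add (LocallyLipschitz.const _)
  · exact (locallyLipschitz_apply _).comp (locallyLipschitz_outputGrad h (hx i) k)

end

/-! ### The random initialization -/

instance (σ₀ : ℝ) (s : Layer) : IsProbabilityMeasure (entryLaw σ₀ s) := by
  cases s <;> simp only [entryLaw] <;> infer_instance

/-- The law of the weights of one hidden unit at initialization. -/
noncomputable def rowLaw (σ₀ : ℝ) (d : ℕ) : Measure (Row d) :=
  (Measure.pi fun p : Layer × Fin d => entryLaw σ₀ p.1).map (WithLp.toLp 2)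

lemma measurePreserving_toLp_rowLaw (σ₀ : ℝ) (d : ℕ) :
    MeasurePreserving (WithLp.toLp 2) (Measure.pi fun p : Layer × Fin d => entryLaw σ₀ p.1)
      (rowLaw σ₀ d) :=
  ⟨WithLp.measurable_toLp 2 _, rfl⟩

lemma measurePreserving_ofLp_rowLaw (σ₀ : ℝ) (d : ℕ) :
    MeasurePreserving (WithLp.ofLp (p := 2)) (rowLaw σ₀ d)
      (Measure.pi fun p : Layer × Fin d => entryLaw σ₀ p.1) where
  measurable := WithLp.measurable_ofLp 2 _
  map_eq := by
    rw [rowLaw, Measure.map_map (WithLp.measurable_ofLp 2 _) (WithLp.measurable_toLp 2 _)]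
    exact Measure.map_id

instance (σ₀ : ℝ) (d : ℕ) : IsProbabilityMeasure (rowLaw σ₀ d) :=
  Measure.isProbabilityMeasure_map (WithLp.measurable_toLp 2 _).aemeasurable

instance (σ₀ : ℝ) (m d : ℕ) : IsProbabilityMeasure (initLaw σ₀ m d) :=
  Measure.isProbabilityMeasure_map (WithLp.measurable_toLp 2 _).aemeasurable

/-- At initialization the hidden units are independent and identically distributed. -/
lemma measurePreserving_rows (σ₀ : ℝ) (m d : ℕ) :
    MeasurePreserving (fun (θ : Params m d) r => row r θ) (initLaw σ₀ m d)
      (Measure.pi fun _ : Fin m => rowLaw σ₀ d) where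
  measurable := measurable_pi_iff.2 fun r => (row r).continuous.measurable
  map_eq := by
    have hflat : (Measure.pi fun p : Layer × Fin m × Fin d => entryLaw σ₀ p.1)
        = (Measure.pi fun _ : Fin m => Measure.pi fun q : Layer × Fin d => entryLaw σ₀ q.1).map
          (fun ω p => ω p.2.1 (p.1, p.2.2)) := by
      refine Measure.pi_eq fun s hs => ?_
      rw [Measure.map_apply (by fun_prop) (MeasurableSet.univ_pi hs)]
      have : (fun (ω : Fin m → Layer × Fin d → ℝ) (p : Layer × Fin m × Fin d) =>
          ω p.2.1 (p.1, p.2.2)) ⁻¹' Set.univ.pi s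
          = Set.univ.pi fun r => Set.univ.pi fun q => s (q.1, r, q.2) := by
        ext ω
        simp only [Set.mem_preimage, Set.mem_pi, Set.mem_univ, true_imp_iff, Prod.forall]
        exact ⟨fun h r s a => h s r a, fun h s r a => h r s a⟩
      rw [this, Measure.pi_pi]
      simp only [Measure.pi_pi, Fintype.prod_prod_type]
      exact Finset.prod_comm
    have hrow : Measurable fun (θ : Params m d) r => row r θ :=
      measurable_pi_iff.2 fun r => (row r).continuous.measurable
    rw [initLaw, hflat, Measure.map_map (WithLp.measurable_toLp 2 _) (by fun_prop),
      Measure.map_map hrow ((WithLp.measurable_toLp 2 _).comp (by fun_prop))]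
    exact Measure.pi_map_pi fun _ => (WithLp.measurable_toLp 2 _).aemeasurable

lemma measurePreserving_row (σ₀ : ℝ) {m : ℕ} (d : ℕ) (r : Fin m) :
    MeasurePreserving (row r) (initLaw σ₀ m d) (rowLaw σ₀ d) :=
  (measurePreserving_eval (fun _ : Fin m => rowLaw σ₀ d) r).comp (measurePreserving_rows σ₀ m d)

lemma integral_comp_of_measurePreserving {X Y : Type*} [MeasurableSpace X] [MeasurableSpace Y]
    {μ : Measure X} {ν : Measure Y} {f : X → Y} (hf : MeasurePreserving f μ ν) {g : Y → ℝ}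
    (hg : AEStronglyMeasurable g ν) : ∫ x, g (f x) ∂μ = ∫ y, g y ∂ν := by
  have := hf.map_eq
  subst this
  rw [integral_map hf.measurable.aemeasurable hg]

/-- The mean square deviation of an average over independent hidden units. -/
lemma average_rows_sq_deviation (σ₀ : ℝ) {m d : ℕ} (hm : 0 < m) {f : Row d → ℝ}
    (hf : MemLp f 2 (rowLaw σ₀ d)) :
    Integrable (fun θ : Params m d =>
        (1 / (m : ℝ) * ∑ r, f (row r θ) - ∫ p, f p ∂rowLaw σ₀ d) ^ 2) (initLaw σ₀ m d) ∧
      ∫ θ : Params m d, (1 / (m : ℝ) * ∑ r, f (row r θ) - ∫ p, f p ∂rowLaw σ₀ d) ^ 2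
        ∂initLaw σ₀ m d ≤ (∫ p, f p ^ 2 ∂rowLaw σ₀ d) / m := by
  have hm' : (0 : ℝ) < m := by exact_mod_cast hm
  set P := Measure.pi fun _ : Fin m => rowLaw σ₀ d
  set S : (Fin m → Row d) → ℝ := ∑ r, fun ω => f (ω r) with hS
  have hSa : ∀ ω, S ω = ∑ r, f (ω r) := fun ω => by simp [hS]
  have hS2 : MemLp S 2 P := memLp_finsetSum' _ fun r _ =>
    hf.comp_measurePreserving (measurePreserving_eval (fun _ : Fin m => rowLaw σ₀ d) r)
  have hmean : ∫ ω, S ω ∂P = m * ∫ p, f p ∂rowLaw σ₀ d := by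
    rw [integral_congr_ae (Eventually.of_forall hSa),
      integral_finsetSum _ fun r _ => (integrable_comp_eval (i := r)
      (μ := fun _ : Fin m => rowLaw σ₀ d) (f := f) (hf.integrable (by norm_num)))]
    have : ∀ r : Fin m, ∫ ω, f (ω r) ∂P = ∫ p, f p ∂rowLaw σ₀ d := fun r =>
      integral_comp_eval (i := r) (μ := fun _ : Fin m => rowLaw σ₀ d) hf.aestronglyMeasurable
    rw [Finset.sum_congr rfl fun r _ => this r, Finset.sum_const, Finset.card_univ,
      Fintype.card_fin, nsmul_eq_mul]
  have hvar : ∫ ω, (S ω - ∫ ω, S ω ∂P) ^ 2 ∂P ≤ m * ∫ p, f p ^ 2 ∂rowLaw σ₀ d := by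
    rw [← variance_eq_integral hS2.aestronglyMeasurable.aemeasurable, hS,
      variance_sum_pi fun _ => hf]
    simp only [Finset.sum_const, Finset.card_univ, Fintype.card_fin, nsmul_eq_mul]
    exact mul_le_mul_of_nonneg_left
      (variance_le_expectation_sq hf.aestronglyMeasurable) hm'.le
  have heq : ∀ ω : Fin m → Row d, (1 / (m : ℝ) * ∑ r, f (ω r) - ∫ p, f p ∂rowLaw σ₀ d) ^ 2
      = 1 / (m : ℝ) ^ 2 * (S ω - ∫ ω, S ω ∂P) ^ 2 := fun ω => by
    rw [hmean, hSa]; field_simp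
  have hint : Integrable (fun ω : Fin m → Row d =>
      (1 / (m : ℝ) * ∑ r, f (ω r) - ∫ p, f p ∂rowLaw σ₀ d) ^ 2) P := by
    simp only [heq]
    exact ((hS2.sub (memLp_const _)).integrable_sq).const_mul _
  refine ⟨(measurePreserving_rows σ₀ m d).integrable_comp_of_integrable hint, ?_⟩
  rw [integral_comp_of_measurePreserving (measurePreserving_rows σ₀ m d)
    (g := fun ω => (1 / (m : ℝ) * ∑ r, f (ω r) - ∫ p, f p ∂rowLaw σ₀ d) ^ 2)
    hint.aestronglyMeasurable]
  simp only [heq]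
  rw [integral_const_mul, le_div_iff₀ hm']
  calc _ ≤ 1 / (m : ℝ) ^ 2 * (m * ∫ p, f p ^ 2 ∂rowLaw σ₀ d) * m := by gcongr
    _ = _ := by field_simp

/-! ### Moments of a hidden unit -/

/-- The fourth moment of the standard normal law. -/
noncomputable def gaussMoment4 : ℝ := ∫ z, z ^ 4 ∂gaussianReal 0 1

lemma integrable_pow_four_gaussian : Integrable (fun z : ℝ => z ^ 4) (gaussianReal 0 1) := by
  have := (memLp_id_gaussianReal (μ := 0) (v := 1) 4).integrable_norm_pow (by norm_num)
  refine this.congr (Eventually.of_forall fun z => ?_)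
  simp only [id, Real.norm_eq_abs]
  norm_num [Even.pow_abs]

lemma gaussMoment4_nonneg : 0 ≤ gaussMoment4 := integral_nonneg fun z => by positivity

/-- The projection of Gaussian noise onto a unit vector is standard normal. -/
lemma measurePreserving_sum_noise {d : ℕ} {xe : EuclideanSpace ℝ (Fin d)} (hx : ‖xe‖ = 1) :
    MeasurePreserving (fun ζ : Fin d → ℝ => ∑ a, ζ a * xe a) (unitNoise d) (gaussianReal 0 1) where
  measurable := by fun_prop
  map_eq := by
    have h1 : (fun ζ : Fin d → ℝ => ∑ a, ζ a * xe a)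
        = (innerSL ℝ xe) ∘ (WithLp.toLp 2 : (Fin d → ℝ) → EuclideanSpace ℝ (Fin d)) := by
      ext ζ
      simp [PiLp.inner_apply]
    rw [h1, ← Measure.map_map (by fun_prop) (by fun_prop), map_pi_eq_stdGaussian,
      IsGaussian.map_eq_gaussianReal, integral_strongDual_stdGaussian, variance_dual_stdGaussian,
      innerSL_apply_norm, hx]
    simp

section

variable {d : ℕ} {φ φ' : ℝ → ℝ} {L β : ℝ} {xe : EuclideanSpace ℝ (Fin d)}

lemma measurePreserving_rowLaw_apply (σ₀ : ℝ) (i : Layer × Fin d) :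
    MeasurePreserving (fun p : Row d => p i) (rowLaw σ₀ d) (entryLaw σ₀ i.1) :=
  (measurePreserving_eval (fun p : Layer × Fin d => entryLaw σ₀ p.1) i).comp
    (measurePreserving_ofLp_rowLaw σ₀ d)

lemma measurePreserving_mean_inner (σ₀ : ℝ) (hx : ‖xe‖ = 1) :
    MeasurePreserving (fun p : Row d => ∑ a, p (.mean, a) * xe a) (rowLaw σ₀ d)
      (gaussianReal 0 1) := by
  have h : MeasurePreserving (fun (ω : Layer × Fin d → ℝ) a => ω (.mean, a))
      (Measure.pi fun p : Layer × Fin d => entryLaw σ₀ p.1) (unitNoise d) :=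
    ⟨by fun_prop, pi_map_injective _ (Prod.mk_right_injective Layer.mean)⟩
  exact (measurePreserving_sum_noise hx).comp (h.comp (measurePreserving_ofLp_rowLaw σ₀ d))

lemma ae_rowLaw_variance (σ₀ : ℝ) (d : ℕ) :
    ∀ᵐ p ∂rowLaw σ₀ d, ∀ a, p (Layer.variance, a) = σ₀ := by
  rw [ae_all_iff]
  intro a
  refine (measurePreserving_rowLaw_apply σ₀ (Layer.variance, a)).quasiMeasurePreserving.ae
    (p := fun z => z = σ₀) ?_
  simp [entryLaw, ae_dirac_eq]

lemma integrable_decoder_pow_four (σ₀ : ℝ) (k : Fin d) :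
    Integrable (fun p : Row d => p (.decoder, k) ^ 4) (rowLaw σ₀ d) :=
  (measurePreserving_rowLaw_apply σ₀ (Layer.decoder, k)).integrable_comp_of_integrable
    integrable_pow_four_gaussian

lemma integral_decoder_pow_four (σ₀ : ℝ) (k : Fin d) :
    ∫ p : Row d, p (.decoder, k) ^ 4 ∂rowLaw σ₀ d = gaussMoment4 :=
  integral_comp_of_measurePreserving
    (measurePreserving_rowLaw_apply σ₀ (Layer.decoder, k)) (g := fun z => z ^ 4)
    integrable_pow_four_gaussian.aestronglyMeasurable

lemma abs_unitMean_le (h : IsSmoothActivation φ φ' L β) (hx : ‖xe‖ = 1) (σ₀ : ℝ) {p : Row d}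
    (hp : ∀ a, p (Layer.variance, a) = σ₀) :
    |unitMean φ xe p| ≤ (|φ 0| + L * |σ₀|) + L * |∑ a, p (.mean, a) * xe a| := by
  set w := ∑ a, p (.mean, a) * xe a
  set X := fun ζ : Fin d → ℝ => ∑ a, ζ a * xe a
  have hX := measurePreserving_sum_noise hx
  have hX2 : Integrable (fun ζ => X ζ ^ 2) (unitNoise d) :=
    hX.integrable_comp_of_integrable integrable_sq_gaussian
  have hX2' : ∫ ζ, X ζ ^ 2 ∂unitNoise d = 1 := by
    rw [integral_comp_of_measurePreserving hX (g := fun z => z ^ 2)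
      integrable_sq_gaussian.aestronglyMeasurable, integral_sq_gaussian]
  have hin : ∀ ζ, inner ℝ (features xe ζ) p = w + σ₀ * X ζ := fun ζ => by
    rw [inner_features, Finset.mul_sum]
    simp only [hp, mul_assoc, w]
  have hb : ∀ ζ, |φ (inner ℝ (features xe ζ) p)|
      ≤ |φ 0| + L * (|w| + |σ₀| * ((1 + X ζ ^ 2) / 2)) := fun ζ => by
    refine (h.abs_le _).trans ?_
    gcongr
    · exact h.L_nonneg
    rw [hin]
    refine (abs_add_le _ _).trans ?_
    rw [abs_mul]
    gcongr
    have := sq_nonneg (|X ζ| - 1)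
    rw [sub_sq, sq_abs] at this
    linarith
  have hint : Integrable (fun ζ => |φ 0| + L * (|w| + |σ₀| * ((1 + X ζ ^ 2) / 2)))
      (unitNoise d) :=
    (integrable_const _).add (((integrable_const _).add
      ((((integrable_const _).add hX2).div_const _).const_mul _)).const_mul _)
  have := norm_integral_le_of_norm_le (f := fun ζ => φ (inner ℝ (features xe ζ) p)) hint
    (Eventually.of_forall hb)
  refine this.trans (le_of_eq ?_)
  have heq : ∀ ζ, |φ 0| + L * (|w| + |σ₀| * ((1 + X ζ ^ 2) / 2))
      = (|φ 0| + L * |w| + L * |σ₀| / 2) + L * |σ₀| / 2 * X ζ ^ 2 := fun ζ => by ring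
  rw [integral_congr_ae (Eventually.of_forall heq), integral_add (integrable_const _)
    (hX2.const_mul _), integral_const_mul, hX2']
  simp
  ring

lemma add_pow_four_le (a b : ℝ) : (a + b) ^ 4 ≤ 8 * (a ^ 4 + b ^ 4) := by
  nlinarith [sq_nonneg (a - b), sq_nonneg (a + b), sq_nonneg (a ^ 2 - b ^ 2),
    sq_nonneg (a * b), mul_nonneg (sq_nonneg (a - b)) (sq_nonneg (a + b)),
    mul_nonneg (sq_nonneg (a - b)) (sq_nonneg (a - b)),
    mul_nonneg (sq_nonneg (a - b)) (sq_nonneg a), mul_nonneg (sq_nonneg (a - b)) (sq_nonneg b)]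

/-- A bound for the fourth moment of the expected activation of a hidden unit. -/
noncomputable def unitMoment (φ : ℝ → ℝ) (L σ₀ : ℝ) : ℝ :=
  8 * ((|φ 0| + L * |σ₀|) ^ 4 + L ^ 4 * gaussMoment4)

lemma unitMoment_nonneg (φ : ℝ → ℝ) (L σ₀ : ℝ) : 0 ≤ unitMoment φ L σ₀ := by
  have := gaussMoment4_nonneg
  rw [unitMoment]
  have : 0 ≤ L ^ 4 := by positivity
  have : 0 ≤ (|φ 0| + L * |σ₀|) ^ 4 := by positivity
  positivity

lemma unitMean_pow_four (h : IsSmoothActivation φ φ' L β) (hx : ‖xe‖ = 1) (σ₀ : ℝ) :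
    Integrable (fun p => unitMean φ xe p ^ 4) (rowLaw σ₀ d) ∧
      ∫ p, unitMean φ xe p ^ 4 ∂rowLaw σ₀ d ≤ unitMoment φ L σ₀ := by
  have hW := measurePreserving_mean_inner σ₀ hx
  have hW4 : Integrable (fun p : Row d => (∑ a, p (.mean, a) * xe a) ^ 4) (rowLaw σ₀ d) :=
    hW.integrable_comp_of_integrable integrable_pow_four_gaussian
  have hW4' : ∫ p : Row d, (∑ a, p (.mean, a) * xe a) ^ 4 ∂rowLaw σ₀ d = gaussMoment4 :=
    integral_comp_of_measurePreserving hW (g := fun z => z ^ 4)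
      integrable_pow_four_gaussian.aestronglyMeasurable
  have hb : ∀ᵐ p ∂rowLaw σ₀ d, ‖unitMean φ xe p ^ 4‖ ≤
      8 * ((|φ 0| + L * |σ₀|) ^ 4 + L ^ 4 * (∑ a, p (.mean, a) * xe a) ^ 4) := by
    filter_upwards [ae_rowLaw_variance σ₀ d] with p hp
    have h1 := abs_unitMean_le h hx σ₀ hp
    rw [norm_pow, Real.norm_eq_abs]
    refine (pow_le_pow_left₀ (abs_nonneg _) h1 4).trans ((add_pow_four_le _ _).trans (le_of_eq ?_))
    rw [mul_pow, Even.pow_abs (by decide)]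
  have hint : Integrable (fun p : Row d =>
      8 * ((|φ 0| + L * |σ₀|) ^ 4 + L ^ 4 * (∑ a, p (.mean, a) * xe a) ^ 4)) (rowLaw σ₀ d) :=
    ((integrable_const _).add (hW4.const_mul _)).const_mul _
  have hi : Integrable (fun p => unitMean φ xe p ^ 4) (rowLaw σ₀ d) :=
    hint.mono' ((locallyLipschitz_unitMean h hx).continuous.pow 4).aestronglyMeasurable hb
  refine ⟨hi, ?_⟩
  calc ∫ p, unitMean φ xe p ^ 4 ∂rowLaw σ₀ d ≤ ∫ p : Row d,
      8 * ((|φ 0| + L * |σ₀|) ^ 4 + L ^ 4 * (∑ a, p (.mean, a) * xe a) ^ 4) ∂rowLaw σ₀ d := by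
        refine integral_mono_ae hi hint ?_
        filter_upwards [hb] with p hp using (le_abs_self _).trans hp
    _ = _ := by
        rw [integral_const_mul, integral_add (integrable_const _) (hW4.const_mul _),
          integral_const_mul, hW4']
        simp [unitMoment]

/-- A bound for the fourth moment of the gradient of a hidden unit. -/
noncomputable def gradMoment (φ : ℝ → ℝ) (L σ₀ : ℝ) : ℝ :=
  8 * ((2 * L) ^ 4 * gaussMoment4 + unitMoment φ L σ₀)

lemma gradMoment_nonneg (φ : ℝ → ℝ) (L σ₀ : ℝ) : 0 ≤ gradMoment φ L σ₀ := by
  have := gaussMoment4_nonneg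
  have := unitMoment_nonneg φ L σ₀
  have : 0 ≤ (2 * L) ^ 4 := by positivity
  rw [gradMoment]
  positivity

lemma norm_neuronGrad_le (h : IsSmoothActivation φ φ' L β) (hx : ‖xe‖ = 1) (k : Fin d)
    (p : Row d) :
    ‖neuronGrad φ φ' xe k p‖ ≤ 2 * L * |p (.decoder, k)| + |unitMean φ xe p| := by
  refine (norm_add_le _ _).trans (add_le_add ?_ ?_)
  · rw [norm_smul, Real.norm_eq_abs, mul_comm]
    exact mul_le_mul_of_nonneg_right (norm_unitMeanGrad_le h hx p) (abs_nonneg _)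
  · rw [norm_smul]; simp

lemma neuronGrad_pow_four (h : IsSmoothActivation φ φ' L β) (hx : ‖xe‖ = 1) (σ₀ : ℝ) (k : Fin d) :
    Integrable (fun p => ‖neuronGrad φ φ' xe k p‖ ^ 4) (rowLaw σ₀ d) ∧
      ∫ p, ‖neuronGrad φ φ' xe k p‖ ^ 4 ∂rowLaw σ₀ d ≤ gradMoment φ L σ₀ := by
  obtain ⟨hu, hu'⟩ := unitMean_pow_four h hx σ₀
  have hv := integrable_decoder_pow_four σ₀ k
  have hb : ∀ p, ‖neuronGrad φ φ' xe k p‖ ^ 4 ≤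
      8 * ((2 * L) ^ 4 * p (.decoder, k) ^ 4 + unitMean φ xe p ^ 4) := fun p => by
    refine (pow_le_pow_left₀ (norm_nonneg _) (norm_neuronGrad_le h hx k p) 4).trans
      ((add_pow_four_le _ _).trans (le_of_eq ?_))
    rw [mul_pow, Even.pow_abs (by decide), Even.pow_abs (by decide)]
  have hint : Integrable (fun p : Row d =>
      8 * ((2 * L) ^ 4 * p (.decoder, k) ^ 4 + unitMean φ xe p ^ 4)) (rowLaw σ₀ d) :=
    ((hv.const_mul _).add hu).const_mul _
  have hi : Integrable (fun p => ‖neuronGrad φ φ' xe k p‖ ^ 4) (rowLaw σ₀ d) :=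
    hint.mono' ((locallyLipschitz_neuronGrad h hx k).continuous.norm.pow 4).aestronglyMeasurable
      (Eventually.of_forall fun p => by
        rw [Real.norm_of_nonneg (by positivity)]; exact hb p)
  refine ⟨hi, (integral_mono hi hint hb).trans ?_⟩
  rw [integral_const_mul, integral_add (hv.const_mul _) hu, integral_const_mul,
    integral_decoder_pow_four, gradMoment]
  gcongr

/-- The contribution of one hidden unit to an entry of the tangent kernel. -/
noncomputable def unitKernel (φ φ' : ℝ → ℝ) (xe ye : EuclideanSpace ℝ (Fin d)) (k l : Fin d)
    (p : Row d) : ℝ :=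
  inner ℝ (neuronGrad φ φ' xe k p) (neuronGrad φ φ' ye l p)

lemma unitKernel_sq (h : IsSmoothActivation φ φ' L β) (hx : ‖xe‖ = 1)
    {ye : EuclideanSpace ℝ (Fin d)} (hy : ‖ye‖ = 1) (σ₀ : ℝ) (k l : Fin d) :
    MemLp (unitKernel φ φ' xe ye k l) 2 (rowLaw σ₀ d) ∧
      ∫ p, unitKernel φ φ' xe ye k l p ^ 2 ∂rowLaw σ₀ d ≤ gradMoment φ L σ₀ := by
  obtain ⟨h1, h1'⟩ := neuronGrad_pow_four h hx σ₀ k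
  obtain ⟨h2, h2'⟩ := neuronGrad_pow_four h hy σ₀ l
  have hb : ∀ p, unitKernel φ φ' xe ye k l p ^ 2 ≤
      (‖neuronGrad φ φ' xe k p‖ ^ 4 + ‖neuronGrad φ φ' ye l p‖ ^ 4) / 2 := fun p => by
    have hcs := abs_real_inner_le_norm (neuronGrad φ φ' xe k p) (neuronGrad φ φ' ye l p)
    have := pow_le_pow_left₀ (abs_nonneg _) hcs 2
    rw [sq_abs] at this
    refine this.trans ?_
    have := sq_nonneg (‖neuronGrad φ φ' xe k p‖ ^ 2 - ‖neuronGrad φ φ' ye l p‖ ^ 2)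
    nlinarith
  have hcont : Continuous (unitKernel φ φ' xe ye k l) :=
    (locallyLipschitz_neuronGrad h hx k).continuous.inner
      (locallyLipschitz_neuronGrad h hy l).continuous
  have hint := (h1.add h2).div_const 2
  have hi : Integrable (fun p => unitKernel φ φ' xe ye k l p ^ 2) (rowLaw σ₀ d) :=
    hint.mono' (hcont.pow 2).aestronglyMeasurable (Eventually.of_forall fun p => by
      rw [Real.norm_of_nonneg (by positivity)]; exact hb p)
  refine ⟨(memLp_two_iff_integrable_sq hcont.aestronglyMeasurable).2 hi,
    (integral_mono hi hint hb).trans ?_⟩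
  simp only [Pi.add_apply]
  rw [integral_div, integral_add h1 h2]
  linarith

lemma neuron_sq (h : IsSmoothActivation φ φ' L β) (hx : ‖xe‖ = 1) (σ₀ : ℝ) (k : Fin d) :
    MemLp (neuron φ xe k) 2 (rowLaw σ₀ d) ∧
      ∫ p, neuron φ xe k p ^ 2 ∂rowLaw σ₀ d ≤ (gaussMoment4 + unitMoment φ L σ₀) / 2 := by
  obtain ⟨hu, hu'⟩ := unitMean_pow_four h hx σ₀
  have hv := integrable_decoder_pow_four σ₀ k
  have hb : ∀ p, neuron φ xe k p ^ 2 ≤ (p (.decoder, k) ^ 4 + unitMean φ xe p ^ 4) / 2 :=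
    fun p => by
      have := sq_nonneg (p (.decoder, k) ^ 2 - unitMean φ xe p ^ 2)
      rw [neuron]; nlinarith
  have hcont : Continuous (neuron φ xe k) := (locallyLipschitz_neuron h hx k).continuous
  have hint := (hv.add hu).div_const 2
  have hi : Integrable (fun p => neuron φ xe k p ^ 2) (rowLaw σ₀ d) :=
    hint.mono' (hcont.pow 2).aestronglyMeasurable (Eventually.of_forall fun p => by
      rw [Real.norm_of_nonneg (by positivity)]; exact hb p)
  refine ⟨(memLp_two_iff_integrable_sq hcont.aestronglyMeasurable).2 hi,
    (integral_mono hi hint hb).trans ?_⟩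
  simp only [Pi.add_apply]
  rw [integral_div, integral_add hv hu, integral_decoder_pow_four]
  gcongr

/-- Changing the sign of the decoder weights of a unit. -/
noncomputable def flipDecoder (p : Row d) : Row d :=
  WithLp.toLp 2 fun i => if i.1 = .decoder then -p i else p i

lemma measurePreserving_flipDecoder (σ₀ : ℝ) (d : ℕ) :
    MeasurePreserving (flipDecoder (d := d)) (rowLaw σ₀ d) (rowLaw σ₀ d) := by
  have h : MeasurePreserving
      (fun (ω : Layer × Fin d → ℝ) (i : Layer × Fin d) => if i.1 = .decoder then -ω i else ω i)
      (Measure.pi fun p : Layer × Fin d => entryLaw σ₀ p.1)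
      (Measure.pi fun p : Layer × Fin d => entryLaw σ₀ p.1) := by
    refine measurePreserving_pi _ _
      (f := fun (i : Layer × Fin d) z => if i.1 = Layer.decoder then -z else z) ?_
    rintro ⟨s, a⟩
    rcases s with _ | _ | _
    · simpa using! MeasurePreserving.id _
    · simpa using! MeasurePreserving.id _
    · refine ⟨by simpa using measurable_neg, ?_⟩
      simp [entryLaw, gaussianReal_map_neg]
  exact (measurePreserving_toLp_rowLaw σ₀ d).comp (h.comp (measurePreserving_ofLp_rowLaw σ₀ d))

/-- The output of a unit is centred, since it is odd in the symmetric decoder weights. -/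
lemma integral_neuron (h : IsSmoothActivation φ φ' L β) (hx : ‖xe‖ = 1) (σ₀ : ℝ) (k : Fin d) :
    ∫ p, neuron φ xe k p ∂rowLaw σ₀ d = 0 := by
  have hodd : ∀ p : Row d, neuron φ xe k (flipDecoder p) = -neuron φ xe k p := fun p => by
    simp [neuron, unitMean, ridgeMean, inner_features, flipDecoder]
  have := integral_comp_of_measurePreserving (measurePreserving_flipDecoder σ₀ d)
    (g := neuron φ xe k) (locallyLipschitz_neuron h hx k).continuous.aestronglyMeasurable
  simp only [hodd, integral_neg] at this
  linarith

lemma decoder_norm_pow_four (σ₀ : ℝ) (d : ℕ) :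
    Integrable (fun p : Row d => (∑ k, p (.decoder, k) ^ 2) ^ 2) (rowLaw σ₀ d) ∧
      ∫ p : Row d, (∑ k, p (.decoder, k) ^ 2) ^ 2 ∂rowLaw σ₀ d ≤ d ^ 2 * gaussMoment4 := by
  have hb : ∀ p : Row d, (∑ k, p (.decoder, k) ^ 2) ^ 2 ≤ d * ∑ k, p (.decoder, k) ^ 4 :=
    fun p => by
      have := sq_sum_le_card_mul_sum_sq (s := (Finset.univ : Finset (Fin d)))
        (f := fun k => p (.decoder, k) ^ 2)
      simpa [← pow_mul] using this
  have hint : Integrable (fun p : Row d => (d : ℝ) * ∑ k, p (.decoder, k) ^ 4) (rowLaw σ₀ d) :=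
    (integrable_finsetSum _ fun k _ => integrable_decoder_pow_four σ₀ k).const_mul _
  have hi : Integrable (fun p : Row d => (∑ k, p (.decoder, k) ^ 2) ^ 2) (rowLaw σ₀ d) :=
    hint.mono' (Continuous.aestronglyMeasurable (by fun_prop))
      (Eventually.of_forall fun p => by
        rw [Real.norm_of_nonneg (by positivity)]; exact hb p)
  refine ⟨hi, (integral_mono hi hint hb).trans (le_of_eq ?_)⟩
  rw [integral_const_mul, integral_finsetSum _ fun k _ => integrable_decoder_pow_four σ₀ k]
  simp only [integral_decoder_pow_four]
  simp; ring

end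

/-! ### Stability of the tangent kernel -/

section

variable {d : ℕ} {φ φ' : ℝ → ℝ} {L β : ℝ}

lemma norm_add_three_sq_le {E : Type*} [SeminormedAddCommGroup E] (a b c : E) :
    ‖a + b + c‖ ^ 2 ≤ 3 * (‖a‖ ^ 2 + ‖b‖ ^ 2 + ‖c‖ ^ 2) := by
  have h : ‖a + b + c‖ ≤ ‖a‖ + ‖b‖ + ‖c‖ := norm_add₃_le
  have := pow_le_pow_left₀ (norm_nonneg _) h 2
  nlinarith [sq_nonneg (‖a‖ - ‖b‖), sq_nonneg (‖b‖ - ‖c‖), sq_nonneg (‖a‖ - ‖c‖)]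

/-- The increment of `∇g` is estimated by the geometric mean of its bound and its Lipschitz bound.
This makes the decoder weights at `q` enter only with the first power of the displacement. -/
lemma sum_norm_neuronGrad_sub_sq_le (h : IsSmoothActivation φ φ' L β)
    {xe : EuclideanSpace ℝ (Fin d)} (hx : ‖xe‖ = 1) (p q : Row d) :
    ∑ k, ‖neuronGrad φ φ' xe k p - neuronGrad φ φ' xe k q‖ ^ 2 ≤
      12 * L ^ 2 * (1 + d) * ‖p - q‖ ^ 2
        + 24 * (L * β) * ((∑ k, q (.decoder, k) ^ 2) * ‖p - q‖) := by
  set g := unitMean φ xe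
  set G := unitMeanGrad φ' xe
  have hL := h.L_nonneg
  have hβ := h.β_nonneg
  have hG : ‖G p - G q‖ ^ 2 ≤ 8 * (L * β) * ‖p - q‖ := by
    have h1 : ‖G p - G q‖ ≤ 4 * L := by
      have := (norm_sub_le (G p) (G q)).trans
        (add_le_add (norm_unitMeanGrad_le h hx p) (norm_unitMeanGrad_le h hx q))
      linarith
    have h2 := norm_unitMeanGrad_sub_le h hx p q
    calc ‖G p - G q‖ ^ 2 = ‖G p - G q‖ * ‖G p - G q‖ := sq _
      _ ≤ 4 * L * (2 * β * ‖p - q‖) := mul_le_mul h1 h2 (norm_nonneg _) (by positivity)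
      _ = _ := by ring
  have hg : (g p - g q) ^ 2 ≤ 4 * L ^ 2 * ‖p - q‖ ^ 2 := by
    have := pow_le_pow_left₀ (abs_nonneg _) (abs_unitMean_sub_le h hx p q) 2
    rw [sq_abs] at this
    calc _ ≤ _ := this
      _ = _ := by ring
  have hGp : ‖G p‖ ^ 2 ≤ 4 * L ^ 2 := by
    have := pow_le_pow_left₀ (norm_nonneg _) (norm_unitMeanGrad_le h hx p) 2
    calc _ ≤ _ := this
      _ = _ := by ring
  have hk : ∀ k, ‖neuronGrad φ φ' xe k p - neuronGrad φ φ' xe k q‖ ^ 2 ≤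
      3 * ((p (.decoder, k) - q (.decoder, k)) ^ 2 * (4 * L ^ 2)
        + q (.decoder, k) ^ 2 * (8 * (L * β) * ‖p - q‖) + 4 * L ^ 2 * ‖p - q‖ ^ 2) := fun k => by
    have he : neuronGrad φ φ' xe k p - neuronGrad φ φ' xe k q
        = (p (.decoder, k) - q (.decoder, k)) • G p + q (.decoder, k) • (G p - G q)
          + (g p - g q) • EuclideanSpace.single (.decoder, k) (1 : ℝ) := by
      simp only [neuronGrad, G, g]; module
    rw [he]
    refine (norm_add_three_sq_le _ _ _).trans ?_
    simp only [norm_smul, mul_pow, Real.norm_eq_abs, sq_abs, PiLp.norm_single, abs_one,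
      mul_one]
    gcongr
  have hdec : ∑ k, (p (.decoder, k) - q (.decoder, k)) ^ 2 ≤ ‖p - q‖ ^ 2 := by
    rw [EuclideanSpace.real_norm_sq_eq, Fintype.sum_prod_type, sum_layer]
    simp only [PiLp.sub_apply]
    exact le_add_of_nonneg_left (by positivity)
  calc _ ≤ ∑ k, 3 * ((p (.decoder, k) - q (.decoder, k)) ^ 2 * (4 * L ^ 2)
        + q (.decoder, k) ^ 2 * (8 * (L * β) * ‖p - q‖) + 4 * L ^ 2 * ‖p - q‖ ^ 2) :=
        Finset.sum_le_sum fun k _ => hk k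
    _ = 3 * ((∑ k, (p (.decoder, k) - q (.decoder, k)) ^ 2) * (4 * L ^ 2)
        + (∑ k, q (.decoder, k) ^ 2) * (8 * (L * β) * ‖p - q‖)
        + d * (4 * L ^ 2 * ‖p - q‖ ^ 2)) := by
        rw [← Finset.mul_sum, Finset.sum_add_distrib, Finset.sum_add_distrib, Finset.sum_mul,
          Finset.sum_mul]
        simp
    _ ≤ 3 * (‖p - q‖ ^ 2 * (4 * L ^ 2)
        + (∑ k, q (.decoder, k) ^ 2) * (8 * (L * β) * ‖p - q‖)
        + d * (4 * L ^ 2 * ‖p - q‖ ^ 2)) := by gcongr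
    _ = _ := by ring

/-- The sum of the fourth powers of the norms of the decoder weights of the units. -/
noncomputable def decoderMoment {m : ℕ} (θ : Params m d) : ℝ :=
  ∑ r, (∑ k, row r θ (.decoder, k) ^ 2) ^ 2

lemma sum_norm_outputGrad_sub_sq_le (h : IsSmoothActivation φ φ' L β)
    {xe : EuclideanSpace ℝ (Fin d)} (hx : ‖xe‖ = 1) {m : ℕ} (θ θ₀ : Params m d) :
    ∑ k, ‖outputGrad φ φ' xe k θ - outputGrad φ φ' xe k θ₀‖ ^ 2 ≤
      1 / (m : ℝ) * (12 * L ^ 2 * (1 + d) * ‖θ - θ₀‖ ^ 2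
        + 24 * (L * β) * (√(decoderMoment θ₀) * ‖θ - θ₀‖)) := by
  have hL := h.L_nonneg
  have hβ := h.β_nonneg
  have h1 : ∀ k, ‖outputGrad φ φ' xe k θ - outputGrad φ φ' xe k θ₀‖ ^ 2 = 1 / (m : ℝ) *
      ∑ r, ‖neuronGrad φ φ' xe k (row r θ) - neuronGrad φ φ' xe k (row r θ₀)‖ ^ 2 := fun k => by
    rw [norm_sq_eq_sum_row, Finset.mul_sum]
    refine Finset.sum_congr rfl fun r _ => ?_
    rw [map_sub, row_outputGrad, row_outputGrad, ← smul_sub, norm_smul, mul_pow,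
      Real.norm_eq_abs, sq_abs, div_pow, one_pow, Real.sq_sqrt m.cast_nonneg]
  simp only [h1]
  rw [← Finset.mul_sum, Finset.sum_comm]
  refine mul_le_mul_of_nonneg_left ?_ (by positivity)
  refine (Finset.sum_le_sum fun r _ =>
    sum_norm_neuronGrad_sub_sq_le h hx (row r θ) (row r θ₀)).trans ?_
  have hcs := Real.sum_mul_le_sqrt_mul_sqrt Finset.univ
    (fun r => ∑ k, row r θ₀ (.decoder, k) ^ 2) (fun r => ‖row r θ - row r θ₀‖)
  have hn : ∑ r, ‖row r θ - row r θ₀‖ ^ 2 = ‖θ - θ₀‖ ^ 2 := by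
    simp only [norm_sq_eq_sum_row (θ - θ₀), map_sub]
  rw [hn, Real.sqrt_sq (norm_nonneg _)] at hcs
  rw [Finset.sum_add_distrib, ← Finset.mul_sum, ← Finset.mul_sum, hn]
  gcongr
  exact hcs

end

/-! ### The Polyak–Łojasiewicz inequality near the initialization -/

section

variable {ι : Type*} [Fintype ι]

/-- Variational characterization of the least eigenvalue of a symmetric matrix. -/
lemma IsLeastEigenvalue.mul_sum_sq_le [DecidableEq ι] {A : Matrix ι ι ℝ} {lam : ℝ}
    (hA : IsLeastEigenvalue A lam) (hsymm : ∀ i j, A i j = A j i) (u : ι → ℝ) :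
    lam * ∑ i, u i ^ 2 ≤ ∑ i, ∑ j, u i * u j * A i j := by
  have hH : (A - lam • (1 : Matrix ι ι ℝ)).IsHermitian := by
    refine Matrix.IsHermitian.ext fun i j => ?_
    simp [hsymm i j, Matrix.one_apply, eq_comm]
  have hP : (A - lam • (1 : Matrix ι ι ℝ)).PosSemidef := by
    rw [hH.posSemidef_iff_eigenvalues_nonneg]
    intro i
    have hv := hH.mulVec_eigenvectorBasis i
    have hne : (hH.eigenvectorBasis i : EuclideanSpace ℝ ι).ofLp ≠ 0 := fun h0 =>
      hH.eigenvectorBasis.orthonormal.ne_zero i (by ext j; simpa using congrFun h0 j)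
    have : Module.End.HasEigenvalue (Matrix.toLin' A) (hH.eigenvalues i + lam) := by
      refine Module.End.hasEigenvalue_of_hasEigenvector
        (x := (hH.eigenvectorBasis i : EuclideanSpace ℝ ι).ofLp)
        ⟨Module.End.mem_eigenspace_iff.2 ?_, hne⟩
      rw [Matrix.sub_mulVec, Matrix.smul_mulVec, Matrix.one_mulVec, sub_eq_iff_eq_add] at hv
      rw [Matrix.toLin'_apply, hv, add_smul]
    have := hA.2 this
    simpa using this
  have h := hP.dotProduct_mulVec_nonneg u
  have h2 : dotProduct u ((A - lam • (1 : Matrix ι ι ℝ)).mulVec u)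
      = (∑ i, ∑ j, u i * u j * A i j) - lam * ∑ i, u i ^ 2 := by
    rw [Matrix.sub_mulVec, Matrix.smul_mulVec, Matrix.one_mulVec, dotProduct_sub,
      dotProduct_smul]
    congr 1
    · simp only [dotProduct, Matrix.mulVec, Finset.mul_sum]
      exact Finset.sum_congr rfl fun i _ => Finset.sum_congr rfl fun j _ => by ring
    · simp [dotProduct, sq]
  simp only [star_trivial] at h
  linarith

lemma IsLeastEigenvalue.nonempty [DecidableEq ι] {A : Matrix ι ι ℝ} {lam : ℝ}
    (hA : IsLeastEigenvalue A lam) : Nonempty ι := by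
  obtain ⟨v, hv⟩ := Module.End.HasEigenvalue.exists_hasEigenvector hA.1
  by_contra hne
  rw [not_nonempty_iff] at hne
  exact hv.2 (Subsingleton.elim _ _)

lemma IsLeastEigenvalue.le_diag [DecidableEq ι] {A : Matrix ι ι ℝ} {lam : ℝ}
    (hA : IsLeastEigenvalue A lam) (hsymm : ∀ i j, A i j = A j i) (i : ι) : lam ≤ A i i := by
  have := hA.mul_sum_sq_le hsymm (Pi.single i 1)
  simpa [Pi.single_apply, ite_pow] using this

lemma norm_sum_smul_sq_le {E : Type*} [SeminormedAddCommGroup E] [NormedSpace ℝ E] (u : ι → ℝ)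
    (v : ι → E) : ‖∑ i, u i • v i‖ ^ 2 ≤ (∑ i, u i ^ 2) * ∑ i, ‖v i‖ ^ 2 := by
  have h1 : ‖∑ i, u i • v i‖ ≤ ∑ i, |u i| * ‖v i‖ :=
    (norm_sum_le _ _).trans (le_of_eq (Finset.sum_congr rfl fun i _ => norm_smul _ _))
  have h2 := Finset.sum_mul_sq_le_sq_mul_sq Finset.univ (fun i => |u i|) (fun i => ‖v i‖)
  simp only [sq_abs] at h2
  exact (pow_le_pow_left₀ (norm_nonneg _) h1 2).trans h2

/-- If the Gram matrix of `w` is close to a matrix with quadratic form at least `lam`, then every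
family `v` close to `w` has a Gram matrix with quadratic form at least `lam / 2`. -/
lemma half_mul_sum_sq_le_norm_sq {E : Type*} [NormedAddCommGroup E] [InnerProductSpace ℝ E]
    {A : ι → ι → ℝ} {lam : ℝ} (hlam : 0 < lam)
    (hA : ∀ u : ι → ℝ, lam * ∑ i, u i ^ 2 ≤ ∑ i, ∑ j, u i * u j * A i j) {v w : ι → E}
    (hw : ∑ p : ι × ι, (inner ℝ (w p.1) (w p.2) - A p.1 p.2) ^ 2 ≤ lam ^ 2 / 16)
    (hvw : ∑ i, ‖v i - w i‖ ^ 2 ≤ lam / 40) (u : ι → ℝ) :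
    lam / 2 * ∑ i, u i ^ 2 ≤ ‖∑ i, u i • v i‖ ^ 2 := by
  set U := ∑ i, u i ^ 2 with hU
  have hU0 : 0 ≤ U := Finset.sum_nonneg fun i _ => sq_nonneg _
  have hgram : ‖∑ i, u i • w i‖ ^ 2 = ∑ i, ∑ j, u i * u j * inner ℝ (w i) (w j) := by
    rw [← real_inner_self_eq_norm_sq, sum_inner]
    simp only [inner_sum, real_inner_smul_left, real_inner_smul_right]
    exact Finset.sum_congr rfl fun i _ => Finset.sum_congr rfl fun j _ => by ring
  have hdiff : |∑ i, ∑ j, u i * u j * (inner ℝ (w i) (w j) - A i j)| ≤ U * (lam / 4) := by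
    refine abs_le_of_sq_le_sq ?_ (by positivity)
    have := Finset.sum_mul_sq_le_sq_mul_sq Finset.univ (fun p : ι × ι => u p.1 * u p.2)
      (fun p => inner ℝ (w p.1) (w p.2) - A p.1 p.2)
    have h2 : ∑ p : ι × ι, (u p.1 * u p.2) ^ 2 = U ^ 2 := by
      rw [Fintype.sum_prod_type, sq U, hU, Finset.sum_mul_sum]
      simp only [mul_pow]
    rw [h2, Fintype.sum_prod_type] at this
    calc _ ≤ _ := this
      _ ≤ U ^ 2 * (lam ^ 2 / 16) := by gcongr
      _ = _ := by ring
  have hwU : 3 / 4 * lam * U ≤ ‖∑ i, u i • w i‖ ^ 2 := by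
    have h1 := hA u
    have h2 : ∑ i, ∑ j, u i * u j * (inner ℝ (w i) (w j) - A i j)
        = ‖∑ i, u i • w i‖ ^ 2 - ∑ i, ∑ j, u i * u j * A i j := by
      rw [hgram]
      simp only [mul_sub, Finset.sum_sub_distrib]
    rw [h2] at hdiff
    have := (abs_le.1 hdiff).1
    linarith
  have he : ‖∑ i, u i • (v i - w i)‖ ^ 2 ≤ U * (lam / 40) :=
    (norm_sum_smul_sq_le u _).trans (mul_le_mul_of_nonneg_left hvw hU0)
  have hsplit : ∑ i, u i • w i = ∑ i, u i • v i - ∑ i, u i • (v i - w i) := by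
    simp only [smul_sub, Finset.sum_sub_distrib, sub_sub_cancel]
  have htri : ‖∑ i, u i • w i‖ ^ 2
      ≤ 5 / 4 * ‖∑ i, u i • v i‖ ^ 2 + 5 * ‖∑ i, u i • (v i - w i)‖ ^ 2 := by
    have h1 := pow_le_pow_left₀ (norm_nonneg _)
      (norm_sub_le (∑ i, u i • v i) (∑ i, u i • (v i - w i))) 2
    rw [← hsplit] at h1
    nlinarith [sq_nonneg (‖∑ i, u i • v i‖ - 4 * ‖∑ i, u i • (v i - w i)‖)]
  linarith

end

lemma mseLoss_eq_sum_prod {n m d : ℕ} (σ ψ : ℝ → ℝ) (x xe : Fin n → EuclideanSpace ℝ (Fin d))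
    (θ : Params m d) : mseLoss σ ψ x xe θ
      = 1 / (2 * (n : ℝ)) * ∑ p : Fin n × Fin d,
        (expectedOutput σ ψ (xe p.1) p.2 θ - x p.1 p.2) ^ 2 := by
  rw [mseLoss, Fintype.sum_prod_type]

/-- The Polyak–Łojasiewicz inequality holds wherever the Jacobian is close to its value at a
point at which the tangent kernel is close to the limiting kernel. -/
lemma mseLoss_PL {n m d : ℕ} {σ ψ φ' : ℝ → ℝ} {x xe : Fin n → EuclideanSpace ℝ (Fin d)}
    {L β : ℝ} (h : IsSmoothActivation (fun u => ψ (σ u)) φ' L β)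
    {A : Matrix (Fin n × Fin d) (Fin n × Fin d) ℝ} {lam : ℝ} (hn : 0 < n) (hlam : 0 < lam)
    (hA : ∀ u : Fin n × Fin d → ℝ, lam * ∑ p, u p ^ 2 ≤ ∑ p, ∑ q, u p * u q * A p q)
    {θ θ₀ : Params m d}
    (hntk : ∑ P : (Fin n × Fin d) × (Fin n × Fin d),
      (ntk σ ψ xe θ₀ P.1 P.2 - A P.1 P.2) ^ 2 ≤ lam ^ 2 / 16)
    (hjac : ∑ p : Fin n × Fin d, ‖outputGrad (fun u => ψ (σ u)) φ' (xe p.1) p.2 θ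
      - outputGrad (fun u => ψ (σ u)) φ' (xe p.1) p.2 θ₀‖ ^ 2 ≤ lam / 40) :
    lam / n * mseLoss σ ψ x xe θ ≤ ‖lossGrad σ ψ φ' x xe θ‖ ^ 2 := by
  have hn' : (0 : ℝ) < n := by exact_mod_cast hn
  simp only [ntk_eq_inner h] at hntk
  have key := half_mul_sum_sq_le_norm_sq (A := A) hlam hA
    (v := fun p : Fin n × Fin d => outputGrad (fun u => ψ (σ u)) φ' (xe p.1) p.2 θ)
    (w := fun p : Fin n × Fin d => outputGrad (fun u => ψ (σ u)) φ' (xe p.1) p.2 θ₀) hntk hjac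
    (fun p => expectedOutput σ ψ (xe p.1) p.2 θ - x p.1 p.2)
  rw [lossGrad, norm_smul, mul_pow, Real.norm_eq_abs, sq_abs, mseLoss_eq_sum_prod]
  rw [Fintype.sum_prod_type (fun p : Fin n × Fin d =>
    (expectedOutput σ ψ (xe p.1) p.2 θ - x p.1 p.2) •
      outputGrad (fun u => ψ (σ u)) φ' (xe p.1) p.2 θ)] at key
  calc lam / n * (1 / (2 * (n : ℝ)) * ∑ p : Fin n × Fin d,
        (expectedOutput σ ψ (xe p.1) p.2 θ - x p.1 p.2) ^ 2)
      = (1 / (n : ℝ)) ^ 2 * (lam / 2 * ∑ p : Fin n × Fin d,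
        (expectedOutput σ ψ (xe p.1) p.2 θ - x p.1 p.2) ^ 2) := by field_simp
    _ ≤ _ := mul_le_mul_of_nonneg_left key (by positivity)

/-! ### The limiting kernel -/

lemma measure_ge_le_of_integral_le {X : Type*} [MeasurableSpace X] {μ : Measure X}
    [IsFiniteMeasure μ] {Z : X → ℝ} {b ε : ℝ} (hZ0 : ∀ x, 0 ≤ Z x) (hZ : Integrable Z μ)
    (hb : ∫ x, Z x ∂μ ≤ b) (hε : 0 < ε) : μ {x | ε ≤ Z x} ≤ ENNReal.ofReal (b / ε) := by
  have h := (mul_meas_ge_le_integral_of_nonneg (Eventually.of_forall hZ0) hZ ε).trans hb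
  rw [← ofReal_measureReal]
  exact ENNReal.ofReal_le_ofReal ((le_div_iff₀' hε).2 h)

section

variable {n d : ℕ} {σ ψ φ' : ℝ → ℝ} {L β : ℝ} {xe : Fin n → EuclideanSpace ℝ (Fin d)}

/-- Mean square concentration of the entries of the tangent kernel. -/
lemma ntk_sq_deviation (h : IsSmoothActivation (fun u => ψ (σ u)) φ' L β)
    (hx : ∀ i, ‖xe i‖ = 1) (σ₀ : ℝ) {m : ℕ} (hm : 0 < m) (p q : Fin n × Fin d) :
    Integrable (fun θ : Params m d => (ntk σ ψ xe θ p q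
        - ∫ w, unitKernel (fun u => ψ (σ u)) φ' (xe p.1) (xe q.1) p.2 q.2 w ∂rowLaw σ₀ d) ^ 2)
        (initLaw σ₀ m d) ∧
      ∫ θ : Params m d, (ntk σ ψ xe θ p q
        - ∫ w, unitKernel (fun u => ψ (σ u)) φ' (xe p.1) (xe q.1) p.2 q.2 w ∂rowLaw σ₀ d) ^ 2
        ∂initLaw σ₀ m d ≤ gradMoment (fun u => ψ (σ u)) L σ₀ / m := by
  obtain ⟨h1, h2⟩ := unitKernel_sq h (hx p.1) (hx q.1) σ₀ p.2 q.2
  obtain ⟨h3, h4⟩ := average_rows_sq_deviation σ₀ hm h1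
  simp only [ntk_eq_average h]
  exact ⟨h3, h4.trans (by gcongr)⟩

/-- By uniqueness of limits in probability, the limiting kernel is the expected contribution of a
single hidden unit. -/
lemma IsLimitingNTK.eq_integral (h : IsSmoothActivation (fun u => ψ (σ u)) φ' L β)
    (hx : ∀ i, ‖xe i‖ = 1) {σ₀ : ℝ} {Θinf : Matrix (Fin n × Fin d) (Fin n × Fin d) ℝ}
    (hΘ : IsLimitingNTK σ ψ σ₀ xe Θinf) (p q : Fin n × Fin d) :
    Θinf p q
      = ∫ w, unitKernel (fun u => ψ (σ u)) φ' (xe p.1) (xe q.1) p.2 q.2 w ∂rowLaw σ₀ d := by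
  set K := ∫ w, unitKernel (fun u => ψ (σ u)) φ' (xe p.1) (xe q.1) p.2 q.2 w ∂rowLaw σ₀ d
  by_contra hne
  have hgap : 0 < |Θinf p q - K| := abs_pos.2 (sub_ne_zero.2 hne)
  set ε := |Θinf p q - K| / 2 with hε
  have hε0 : 0 < ε := by positivity
  have h1 := hΘ p q ε hε0
  have h2 : Tendsto (fun m : ℕ =>
      ENNReal.ofReal (gradMoment (fun u => ψ (σ u)) L σ₀ / m / ε ^ 2)) atTop (𝓝 0) := by
    rw [← ENNReal.ofReal_zero]
    refine ENNReal.tendsto_ofReal ?_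
    simpa using (tendsto_const_div_atTop_nhds_zero_nat
      (gradMoment (fun u => ψ (σ u)) L σ₀)).div_const (ε ^ 2)
  have hsum := h1.add h2
  rw [add_zero] at hsum
  refine absurd (ge_of_tendsto (b := (1 : ENNReal)) hsum ?_) (by simp)
  filter_upwards [eventually_gt_atTop 0] with m hm
  obtain ⟨h3, h4⟩ := ntk_sq_deviation h hx σ₀ hm p q
  have h5 := measure_ge_le_of_integral_le (fun θ => sq_nonneg _) h3 h4
    (by positivity : (0 : ℝ) < ε ^ 2)
  refine le_trans ?_ (add_le_add le_rfl h5)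
  rw [← measure_univ (μ := initLaw σ₀ m d)]
  refine (measure_mono fun θ _ => ?_).trans (measure_union_le _ _)
  by_contra hcon
  simp only [Set.mem_union, Set.mem_ofPred_eq, not_or, not_le] at hcon
  have h6 : |ntk σ ψ xe θ p q - K| < ε := abs_lt_of_sq_lt_sq hcon.2 hε0.le
  have h7 : |Θinf p q - K| ≤ |ntk σ ψ xe θ p q - Θinf p q| + |ntk σ ψ xe θ p q - K| := by
    rw [abs_sub_comm (ntk σ ψ xe θ p q) (Θinf p q)]
    exact abs_sub_le _ _ _
  linarith [hcon.1]

lemma IsLimitingNTK.symm (h : IsSmoothActivation (fun u => ψ (σ u)) φ' L β)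
    (hx : ∀ i, ‖xe i‖ = 1) {σ₀ : ℝ} {Θinf : Matrix (Fin n × Fin d) (Fin n × Fin d) ℝ}
    (hΘ : IsLimitingNTK σ ψ σ₀ xe Θinf) (p q : Fin n × Fin d) : Θinf p q = Θinf q p := by
  rw [hΘ.eq_integral h hx, hΘ.eq_integral h hx]
  simp only [unitKernel, real_inner_comm]

lemma IsLimitingNTK.diag_le (h : IsSmoothActivation (fun u => ψ (σ u)) φ' L β)
    (hx : ∀ i, ‖xe i‖ = 1) {σ₀ : ℝ} {Θinf : Matrix (Fin n × Fin d) (Fin n × Fin d) ℝ}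
    (hΘ : IsLimitingNTK σ ψ σ₀ xe Θinf) (p : Fin n × Fin d) :
    Θinf p p ≤ 1 + gradMoment (fun u => ψ (σ u)) L σ₀ := by
  obtain ⟨h1, h2⟩ := unitKernel_sq h (hx p.1) (hx p.1) σ₀ p.2 p.2
  rw [hΘ.eq_integral h hx]
  calc _ ≤ ∫ w, (1 + unitKernel (fun u => ψ (σ u)) φ' (xe p.1) (xe p.1) p.2 p.2 w ^ 2)
        ∂rowLaw σ₀ d := by
        refine integral_mono (h1.integrable (by norm_num))
          ((integrable_const _).add h1.integrable_sq) fun w => ?_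
        simp only
        nlinarith [sq_nonneg (unitKernel (fun u => ψ (σ u)) φ' (xe p.1) (xe p.1) p.2 p.2 w - 1)]
    _ ≤ _ := by
        rw [integral_add (integrable_const _) h1.integrable_sq]
        simpa using h2

/-! ### Random quantities at initialization -/

lemma ntk_sq_distance (h : IsSmoothActivation (fun u => ψ (σ u)) φ' L β)
    (hx : ∀ i, ‖xe i‖ = 1) {σ₀ : ℝ} {Θinf : Matrix (Fin n × Fin d) (Fin n × Fin d) ℝ}
    (hΘ : IsLimitingNTK σ ψ σ₀ xe Θinf) {m : ℕ} (hm : 0 < m) :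
    Integrable (fun θ : Params m d => ∑ P : (Fin n × Fin d) × (Fin n × Fin d),
        (ntk σ ψ xe θ P.1 P.2 - Θinf P.1 P.2) ^ 2) (initLaw σ₀ m d) ∧
      ∫ θ : Params m d, ∑ P : (Fin n × Fin d) × (Fin n × Fin d),
        (ntk σ ψ xe θ P.1 P.2 - Θinf P.1 P.2) ^ 2 ∂initLaw σ₀ m d
        ≤ (n * d) ^ 2 * (gradMoment (fun u => ψ (σ u)) L σ₀ / m) := by
  have hP : ∀ P : (Fin n × Fin d) × (Fin n × Fin d),
      Integrable (fun θ : Params m d => (ntk σ ψ xe θ P.1 P.2 - Θinf P.1 P.2) ^ 2)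
        (initLaw σ₀ m d) ∧
      ∫ θ : Params m d, (ntk σ ψ xe θ P.1 P.2 - Θinf P.1 P.2) ^ 2 ∂initLaw σ₀ m d
        ≤ gradMoment (fun u => ψ (σ u)) L σ₀ / m := fun P => by
    rw [hΘ.eq_integral h hx]
    exact ntk_sq_deviation h hx σ₀ hm P.1 P.2
  refine ⟨integrable_finsetSum _ fun P _ => (hP P).1, ?_⟩
  rw [integral_finsetSum _ fun P _ => (hP P).1]
  refine (Finset.sum_le_sum fun P _ => (hP P).2).trans (le_of_eq ?_)
  simp only [Finset.sum_const, Finset.card_univ, Fintype.card_prod, Fintype.card_fin, nsmul_eq_mul]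
  push_cast
  ring

lemma decoderMoment_integral (σ₀ : ℝ) (m d : ℕ) :
    Integrable (fun θ : Params m d => decoderMoment θ) (initLaw σ₀ m d) ∧
      ∫ θ : Params m d, decoderMoment θ ∂initLaw σ₀ m d ≤ m * (d ^ 2 * gaussMoment4) := by
  obtain ⟨h1, h2⟩ := decoder_norm_pow_four σ₀ d
  have hr : ∀ r : Fin m, Integrable
      (fun θ : Params m d => (∑ k, row r θ (.decoder, k) ^ 2) ^ 2) (initLaw σ₀ m d) := fun r =>
    (measurePreserving_row σ₀ d r).integrable_comp_of_integrable h1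
  refine ⟨integrable_finsetSum _ fun r _ => hr r, ?_⟩
  simp only [decoderMoment]
  rw [integral_finsetSum _ fun r _ => hr r]
  have hr' : ∀ r : Fin m, ∫ θ : Params m d, (∑ k, row r θ (.decoder, k) ^ 2) ^ 2 ∂initLaw σ₀ m d
      ≤ d ^ 2 * gaussMoment4 := fun r => by
    rw [integral_comp_of_measurePreserving (measurePreserving_row σ₀ d r)
      (g := fun p : Row d => (∑ k, p (.decoder, k) ^ 2) ^ 2) h1.aestronglyMeasurable]
    exact h2
  refine (Finset.sum_le_sum fun r _ => hr' r).trans (le_of_eq ?_)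
  simp

/-- The mean square of an output at initialization does not grow with the width, since the
contributions of the units are centred and independent. -/
lemma expectedOutput_sq (h : IsSmoothActivation (fun u => ψ (σ u)) φ' L β)
    {ye : EuclideanSpace ℝ (Fin d)} (hy : ‖ye‖ = 1) (σ₀ : ℝ) {m : ℕ} (hm : 0 < m) (k : Fin d) :
    Integrable (fun θ : Params m d => expectedOutput σ ψ ye k θ ^ 2) (initLaw σ₀ m d) ∧
      ∫ θ : Params m d, expectedOutput σ ψ ye k θ ^ 2 ∂initLaw σ₀ m d
        ≤ (gaussMoment4 + unitMoment (fun u => ψ (σ u)) L σ₀) / 2 := by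
  have hm' : (0 : ℝ) < m := by exact_mod_cast hm
  obtain ⟨h1, h2⟩ := neuron_sq h hy σ₀ k
  obtain ⟨h3, h4⟩ := average_rows_sq_deviation σ₀ hm h1
  rw [integral_neuron h hy] at h3 h4
  have heq : ∀ θ : Params m d, expectedOutput σ ψ ye k θ ^ 2 = m *
      (1 / (m : ℝ) * ∑ r, neuron (fun u => ψ (σ u)) ye k (row r θ) - 0) ^ 2 := fun θ => by
    rw [expectedOutput_eq h, sub_zero, mul_pow, mul_pow, div_pow, Real.sq_sqrt hm'.le]
    field_simp
  simp only [heq]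
  refine ⟨h3.const_mul _, ?_⟩
  rw [integral_const_mul]
  calc _ ≤ (m : ℝ) * ((∫ p, neuron (fun u => ψ (σ u)) ye k p ^ 2 ∂rowLaw σ₀ d) / m) := by gcongr
    _ = ∫ p, neuron (fun u => ψ (σ u)) ye k p ^ 2 ∂rowLaw σ₀ d := by field_simp
    _ ≤ _ := h2

lemma mseLoss_integral (h : IsSmoothActivation (fun u => ψ (σ u)) φ' L β)
    (hx : ∀ i, ‖xe i‖ = 1) {x : Fin n → EuclideanSpace ℝ (Fin d)} {B : ℝ}
    (hB : ∀ i, ‖x i‖ ≤ B) (σ₀ : ℝ) {m : ℕ} (hm : 0 < m) (hn : 0 < n) (hd : 0 < d) :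
    Integrable (fun θ : Params m d => mseLoss σ ψ x xe θ) (initLaw σ₀ m d) ∧
      ∫ θ : Params m d, mseLoss σ ψ x xe θ ∂initLaw σ₀ m d
        ≤ d * ((gaussMoment4 + unitMoment (fun u => ψ (σ u)) L σ₀) / 2 + B ^ 2) := by
  have hn' : (0 : ℝ) < n := by exact_mod_cast hn
  have hd' : (1 : ℝ) ≤ d := by exact_mod_cast hd
  set κ := (gaussMoment4 + unitMoment (fun u => ψ (σ u)) L σ₀) / 2
  have hf : ∀ i k, Integrable (fun θ : Params m d => expectedOutput σ ψ (xe i) k θ ^ 2)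
      (initLaw σ₀ m d) := fun i k => (expectedOutput_sq h (hx i) σ₀ hm k).1
  have hb : ∀ θ : Params m d, mseLoss σ ψ x xe θ ≤
      1 / (n : ℝ) * ∑ i, ((∑ k, expectedOutput σ ψ (xe i) k θ ^ 2) + B ^ 2) := fun θ => by
    rw [mseLoss, show 1 / (2 * (n : ℝ)) = 1 / n * (1 / 2) by field_simp, mul_assoc]
    refine mul_le_mul_of_nonneg_left ?_ (by positivity)
    rw [Finset.mul_sum]
    refine Finset.sum_le_sum fun i _ => ?_
    have h1 : ∑ k, (expectedOutput σ ψ (xe i) k θ - x i k) ^ 2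
        ≤ ∑ k, (2 * expectedOutput σ ψ (xe i) k θ ^ 2 + 2 * x i k ^ 2) :=
      Finset.sum_le_sum fun k _ => by
        nlinarith [sq_nonneg (expectedOutput σ ψ (xe i) k θ + x i k)]
    rw [Finset.sum_add_distrib, ← Finset.mul_sum, ← Finset.mul_sum,
      ← EuclideanSpace.real_norm_sq_eq] at h1
    have h2 := pow_le_pow_left₀ (norm_nonneg _) (hB i) 2
    linarith
  have hint : Integrable (fun θ : Params m d =>
      1 / (n : ℝ) * ∑ i, ((∑ k, expectedOutput σ ψ (xe i) k θ ^ 2) + B ^ 2)) (initLaw σ₀ m d) :=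
    (integrable_finsetSum _ fun i _ =>
      (integrable_finsetSum _ fun k _ => hf i k).add (integrable_const _)).const_mul _
  have hcont : Continuous (mseLoss (m := m) σ ψ x xe) := continuous_iff_continuousAt.2 fun θ =>
    (hasGradientAt_mseLoss h x xe θ).continuousAt
  have hi : Integrable (fun θ : Params m d => mseLoss σ ψ x xe θ) (initLaw σ₀ m d) :=
    hint.mono' hcont.aestronglyMeasurable (Eventually.of_forall fun θ => by
      rw [Real.norm_of_nonneg (by rw [mseLoss]; positivity)]; exact hb θ)
  refine ⟨hi, (integral_mono hi hint hb).trans ?_⟩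
  have hfi : ∀ i, Integrable (fun θ : Params m d =>
      (∑ k, expectedOutput σ ψ (xe i) k θ ^ 2) + B ^ 2) (initLaw σ₀ m d) := fun i =>
    (integrable_finsetSum _ fun k _ => hf i k).add (integrable_const _)
  rw [integral_const_mul, integral_finsetSum _ fun i _ => hfi i]
  have hin : ∀ i, ∫ θ : Params m d, ((∑ k, expectedOutput σ ψ (xe i) k θ ^ 2) + B ^ 2)
      ∂initLaw σ₀ m d ≤ d * κ + B ^ 2 := fun i => by
    rw [integral_add (integrable_finsetSum _ fun k _ => hf i k) (integrable_const _),
      integral_finsetSum _ fun k _ => hf i k]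
    have := Finset.sum_le_sum fun (k : Fin d) (_ : k ∈ Finset.univ) =>
      (expectedOutput_sq h (hx i) σ₀ hm k).2
    simp only [Finset.sum_const, Finset.card_univ, Fintype.card_fin, nsmul_eq_mul] at this
    simpa using this
  calc _ ≤ 1 / (n : ℝ) * ∑ _i : Fin n, (d * κ + B ^ 2) := by
        gcongr with i; exact hin i
    _ = d * κ + B ^ 2 := by simp; field_simp
    _ ≤ _ := by
        rw [mul_add]
        gcongr
        exact le_mul_of_one_le_left (sq_nonneg _) hd'

end

/-! ### Convergence of the gradient flow -/

/-- The composition of Lipschitz functions with Lipschitz derivatives is again such a function. -/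
lemma isSmoothActivation_comp {σ ψ : ℝ → ℝ} (hσ : Differentiable ℝ σ) (hψ : Differentiable ℝ ψ)
    {L β : ℝ} (hσL : ∀ u v : ℝ, |σ u - σ v| ≤ L * |u - v|)
    (hσβ : ∀ u v : ℝ, |deriv σ u - deriv σ v| ≤ β * |u - v|)
    (hψL : ∀ u v : ℝ, |ψ u - ψ v| ≤ L * |u - v|)
    (hψβ : ∀ u v : ℝ, |deriv ψ u - deriv ψ v| ≤ β * |u - v|) :
    IsSmoothActivation (fun u => ψ (σ u)) (fun u => deriv ψ (σ u) * deriv σ u) (L * L)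
      (β * L * L + L * β) := by
  have hL : 0 ≤ L := by simpa using (abs_nonneg _).trans (hσL 1 0)
  have hβ : 0 ≤ β := by simpa using (abs_nonneg _).trans (hσβ 1 0)
  have hd : ∀ f : ℝ → ℝ, (∀ u v : ℝ, |f u - f v| ≤ L * |u - v|) → ∀ u, |deriv f u| ≤ L := by
    intro f hf u
    have := norm_deriv_le_of_lipschitz (x₀ := u) (LipschitzWith.of_dist_le' (f := f) fun u v => by
      rw [Real.dist_eq, Real.dist_eq]; exact hf u v)
    simpa [hL] using this
  refine ⟨fun u => (hψ (σ u)).hasDerivAt.comp u (hσ u).hasDerivAt, fun u => ?_, fun u v => ?_⟩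
  · rw [abs_mul]
    exact mul_le_mul (hd ψ hψL _) (hd σ hσL _) (abs_nonneg _) hL
  · calc |deriv ψ (σ u) * deriv σ u - deriv ψ (σ v) * deriv σ v|
        = |(deriv ψ (σ u) - deriv ψ (σ v)) * deriv σ u
          + deriv ψ (σ v) * (deriv σ u - deriv σ v)| := by congr 1; ring
      _ ≤ |deriv ψ (σ u) - deriv ψ (σ v)| * |deriv σ u|
          + |deriv ψ (σ v)| * |deriv σ u - deriv σ v| := by
        rw [← abs_mul, ← abs_mul]; exact abs_add_le _ _
      _ ≤ β * (L * |u - v|) * L + L * (β * |u - v|) := by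
        gcongr
        · exact (hψβ _ _).trans (mul_le_mul_of_nonneg_left (hσL u v) hβ)
        · exact hd σ hσL u
        · exact hd ψ hψL _
        · exact hσβ u v
      _ = _ := by ring

/-- The deterministic part of the convergence theorem: gradient flow converges linearly from every
initialization with small loss, small decoder weights and tangent kernel close to its limit. -/
lemma gradientFlow_converges {n m d : ℕ} {σ ψ φ' : ℝ → ℝ}
    {x xe : Fin n → EuclideanSpace ℝ (Fin d)} {L β : ℝ}
    (h : IsSmoothActivation (fun u => ψ (σ u)) φ' L β) (hx : ∀ i, ‖xe i‖ = 1)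
    {A : Matrix (Fin n × Fin d) (Fin n × Fin d) ℝ} {lam H Q : ℝ} (hn : 0 < n)
    (hlam : 0 < lam) (hH : 0 < H)
    (hA : ∀ u : Fin n × Fin d → ℝ, lam * ∑ p, u p ^ 2 ≤ ∑ p, ∑ q, u p * u q * A p q)
    {θ₀ : Params m d} (hloss : mseLoss σ ψ x xe θ₀ ≤ H)
    (hntk : ∑ P : (Fin n × Fin d) × (Fin n × Fin d),
      (ntk σ ψ xe θ₀ P.1 P.2 - A P.1 P.2) ^ 2 ≤ lam ^ 2 / 16)
    (hdec : decoderMoment θ₀ ≤ Q)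
    (hsmall : n * (1 / (m : ℝ) * (12 * L ^ 2 * (1 + d) * (9 * (H * n / lam))
        + 24 * (L * β) * √(Q * (9 * (H * n / lam))))) ≤ lam / 40) :
    (∃ θ : ℝ → Params m d, IsGradientFlow (mseLoss σ ψ x xe) θ₀ θ) ∧
      ∀ θ : ℝ → Params m d, IsGradientFlow (mseLoss σ ψ x xe) θ₀ θ → ∀ t : ℝ, 0 ≤ t →
        mseLoss σ ψ x xe (θ t) ≤ Real.exp (-(lam / (n : ℝ)) * t) * mseLoss σ ψ x xe (θ 0) := by
  have hn' : (0 : ℝ) < n := by exact_mod_cast hn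
  have hL := h.L_nonneg
  have hβ := h.β_nonneg
  have hc : 0 < lam / (n : ℝ) := by positivity
  set R := 3 * √(H / (lam / n)) with hR
  have hs : 0 < √(H / (lam / n)) := Real.sqrt_pos.2 (by positivity)
  have hR2 : R ^ 2 = 9 * (H * n / lam) := by
    rw [hR, mul_pow, Real.sq_sqrt (by positivity)]
    field_simp
    norm_num
  have hR0 : 0 ≤ R := by positivity
  refine gradientFlow_of_PL (R := R) hc hH (by rw [hR]; linarith)
    (fun θ => by rw [mseLoss]; positivity) hloss (hasGradientAt_mseLoss h x xe)
    (locallyLipschitz_lossGrad h x hx) fun θ hθ => ?_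
  refine mseLoss_PL h hn hlam hA hntk ?_
  rw [Metric.mem_closedBall, dist_eq_norm] at hθ
  have hbound : ∀ i : Fin n, ∑ k, ‖outputGrad (fun u => ψ (σ u)) φ' (xe i) k θ
      - outputGrad (fun u => ψ (σ u)) φ' (xe i) k θ₀‖ ^ 2 ≤
      1 / (m : ℝ) * (12 * L ^ 2 * (1 + d) * (9 * (H * n / lam))
        + 24 * (L * β) * √(Q * (9 * (H * n / lam)))) := fun i => by
    refine (sum_norm_outputGrad_sub_sq_le h (hx i) θ θ₀).trans ?_
    have h1 : ‖θ - θ₀‖ ^ 2 ≤ 9 * (H * n / lam) := by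
      rw [← hR2]; exact pow_le_pow_left₀ (norm_nonneg _) hθ 2
    have h2 : √(decoderMoment θ₀) * ‖θ - θ₀‖ ≤ √(Q * (9 * (H * n / lam))) := by
      rw [Real.sqrt_mul' _ (by positivity), ← hR2, Real.sqrt_sq hR0]
      exact mul_le_mul (Real.sqrt_le_sqrt hdec) hθ (norm_nonneg _) (Real.sqrt_nonneg _)
    gcongr
  rw [Fintype.sum_prod_type]
  refine (Finset.sum_le_sum fun i _ => hbound i).trans ?_
  simpa using hsmall

/-- The width requirement makes the Jacobian stable on the ball which contains the trajectory, and
bounds the failure probability of the concentration of the kernel. -/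
lemma width_bounds {n d m K κ lam δ G Λ L b : ℝ} (hn : 1 ≤ n) (hd : 1 ≤ d) (hm : 0 < m)
    (hK : 0 < K) (hκ : 0 < κ) (hlam : 0 < lam) (hδ : 0 < δ) (hδ1 : δ < 1) (hG : 0 ≤ G)
    (hΛ : lam ≤ Λ) (hΛ1 : 1 ≤ Λ)
    (hwidth : (1 + (48 * G + 51840 * L ^ 2 * K + (17280 * b) ^ 2 * κ * K) * Λ ^ 2)
      * (n ^ 5 * d ^ 3 / (lam ^ 4 * δ ^ 2)) ≤ m) :
    n * (1 / m * (12 * L ^ 2 * (1 + d) * (9 * ((3 * d * K / δ) * n / lam))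
        + 24 * b * √((3 * m * d ^ 2 * κ / δ) * (9 * ((3 * d * K / δ) * n / lam))))) ≤ lam / 40
      ∧ (n * d) ^ 2 * (G / m) / (lam ^ 2 / 16) ≤ δ / 3 := by
  set X := n ^ 5 * d ^ 3 / (lam ^ 4 * δ ^ 2) with hX
  have hX0 : 0 < X := by positivity
  have hΛ0 : 0 < Λ := by linarith
  have hn0 : 0 < n := by linarith
  have hd0 : 0 < d := by linarith
  -- `Y` controls the kernel at initialization and the terms quadratic in the displacement, `Z` the
  -- terms weighted by the decoder rows.
  have hY : n ^ 2 * d ^ 2 / (δ * lam ^ 2) ≤ Λ ^ 2 * X := by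
    have : n ^ 2 * d ^ 2 / (δ * lam ^ 2) * (n ^ 3 * d * (1 / δ) * (1 / lam) ^ 2) = X := by
      rw [hX]; field_simp
    have h1 : 1 ≤ n ^ 3 * d * (1 / δ) := by
      have e1 : 1 ≤ n ^ 3 := one_le_pow₀ hn
      have e2 : 1 ≤ 1 / δ := (one_le_div hδ).2 hδ1.le
      exact one_le_mul_of_one_le_of_one_le (one_le_mul_of_one_le_of_one_le e1 hd) e2
    have h2 : 1 ≤ (Λ * (1 / lam)) ^ 2 := one_le_pow₀ (by
      rw [mul_one_div]; exact (one_le_div hlam).2 hΛ)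
    have h3 : 0 ≤ n ^ 2 * d ^ 2 / (δ * lam ^ 2) := by positivity
    calc n ^ 2 * d ^ 2 / (δ * lam ^ 2) ≤ n ^ 2 * d ^ 2 / (δ * lam ^ 2) *
          (n ^ 3 * d * (1 / δ) * (Λ * (1 / lam)) ^ 2) :=
          le_mul_of_one_le_right h3 (one_le_mul_of_one_le_of_one_le h1 h2)
      _ = Λ ^ 2 * X := by rw [← this]; ring
  have hZ : n ^ 3 * d ^ 3 / (δ ^ 2 * lam ^ 3) ≤ Λ ^ 2 * X := by
    have : n ^ 3 * d ^ 3 / (δ ^ 2 * lam ^ 3) * (n ^ 2 * (1 / lam)) = X := by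
      rw [hX]; field_simp
    have h1 : 1 ≤ n ^ 2 := one_le_pow₀ hn
    have h2 : 1 ≤ Λ * (1 / lam) := by
      rw [mul_one_div]; exact (one_le_div hlam).2 hΛ
    have h3 : 0 ≤ n ^ 3 * d ^ 3 / (δ ^ 2 * lam ^ 3) := by positivity
    calc n ^ 3 * d ^ 3 / (δ ^ 2 * lam ^ 3) ≤ n ^ 3 * d ^ 3 / (δ ^ 2 * lam ^ 3) *
          (n ^ 2 * (Λ * (1 / lam)) * Λ) := le_mul_of_one_le_right h3
          (one_le_mul_of_one_le_of_one_le (one_le_mul_of_one_le_of_one_le h1 h2) hΛ1)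
      _ = Λ ^ 2 * X := by rw [← this]; ring
  set Y := n ^ 2 * d ^ 2 / (δ * lam ^ 2) with hYdef
  set Z := n ^ 3 * d ^ 3 / (δ ^ 2 * lam ^ 3) with hZdef
  have e0 : 0 ≤ G * (Λ ^ 2 * X) := by positivity
  have e1 : 0 ≤ L ^ 2 * K * (Λ ^ 2 * X) := by positivity
  have e2 : 0 ≤ (17280 * b) ^ 2 * κ * K * (Λ ^ 2 * X) := by positivity
  have hm0 : 48 * G * Y ≤ m := by
    have := mul_le_mul_of_nonneg_left hY hG
    nlinarith
  have hm1 : 51840 * L ^ 2 * K * Y ≤ m := by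
    have := mul_le_mul_of_nonneg_left hY (by positivity : 0 ≤ L ^ 2 * K)
    nlinarith
  have hm2 : (17280 * b) ^ 2 * κ * K * Z ≤ m := by
    have := mul_le_mul_of_nonneg_left hZ (by positivity : 0 ≤ (17280 * b) ^ 2 * κ * K)
    nlinarith
  constructor
  · have t1 : n * (1 / m * (12 * L ^ 2 * (1 + d) * (9 * ((3 * d * K / δ) * n / lam))))
        ≤ lam / 80 := by
      calc n * (1 / m * (12 * L ^ 2 * (1 + d) * (9 * ((3 * d * K / δ) * n / lam))))
          ≤ n * (1 / m * (12 * L ^ 2 * (d + d) * (9 * ((3 * d * K / δ) * n / lam)))) := by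
            gcongr
        _ = lam / 80 * (51840 * L ^ 2 * K * Y) / m := by rw [hYdef]; field_simp; ring
        _ ≤ lam / 80 := by
            rw [div_le_iff₀ hm]
            exact mul_le_mul_of_nonneg_left hm1 (by positivity)
    have t2 : n * (1 / m * (24 * b *
        √((3 * m * d ^ 2 * κ / δ) * (9 * ((3 * d * K / δ) * n / lam)))))
        ≤ lam / 80 := by
      refine abs_le_of_sq_le_sq' ?_ (by positivity) |>.2
      rw [mul_pow, mul_pow, mul_pow, Real.sq_sqrt (by positivity)]
      calc n ^ 2 * ((1 / m) ^ 2 * ((24 * b) ^ 2 *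
            ((3 * m * d ^ 2 * κ / δ) * (9 * ((3 * d * K / δ) * n / lam)))))
          = (lam / 80) ^ 2 * ((17280 * b) ^ 2 * κ * K * Z) / m := by
            rw [hZdef]; field_simp; ring
        _ ≤ (lam / 80) ^ 2 := by
            rw [div_le_iff₀ hm]
            exact mul_le_mul_of_nonneg_left hm2 (by positivity)
    calc _ = n * (1 / m * (12 * L ^ 2 * (1 + d) * (9 * ((3 * d * K / δ) * n / lam))))
        + n * (1 / m * (24 * b *
          √((3 * m * d ^ 2 * κ / δ) * (9 * ((3 * d * K / δ) * n / lam))))) := by ring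
      _ ≤ lam / 80 + lam / 80 := add_le_add t1 t2
      _ = _ := by ring
  · calc (n * d) ^ 2 * (G / m) / (lam ^ 2 / 16) = δ / 3 * (48 * G * Y) / m := by
          rw [hYdef]; field_simp; ring
      _ ≤ δ / 3 := by
          rw [div_le_iff₀ hm]
          exact mul_le_mul_of_nonneg_left hm0 (by positivity)

end VAE

theorem theorem1
    (σ ψ : ℝ → ℝ) (hσ : ContDiff ℝ 1 σ) (hψ : Differentiable ℝ ψ)
    (L β : ℝ)
    (hσL : ∀ u v : ℝ, |σ u - σ v| ≤ L * |u - v|)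
    (hσβ : ∀ u v : ℝ, |deriv σ u - deriv σ v| ≤ β * |u - v|)
    (hψL : ∀ u v : ℝ, |ψ u - ψ v| ≤ L * |u - v|)
    (hψβ : ∀ u v : ℝ, |deriv ψ u - deriv ψ v| ≤ β * |u - v|)
    (σ₀ B : ℝ) :
    ∃ C : ℝ, 0 < C ∧
      ∀ (n d : ℕ) (x xe : Fin n → EuclideanSpace ℝ (Fin d)),
        (∀ i, ‖xe i‖ = 1) → (∀ i, ‖x i‖ ≤ B) →
      ∀ (Θinf : Matrix (Fin n × Fin d) (Fin n × Fin d) ℝ) (lam₀ : ℝ),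
        VAE.IsLimitingNTK σ ψ σ₀ xe Θinf →
        VAE.IsLeastEigenvalue Θinf lam₀ → 0 < lam₀ →
      ∀ δ : ℝ, 0 < δ → δ < 1 →
      ∀ m : ℕ,
        C * max ((n : ℝ) ^ 5 * (d : ℝ) ^ 3 / (lam₀ ^ 4 * δ ^ 2))
            ((n : ℝ) ^ 2 * (d : ℝ) ^ 2 / lam₀ * Real.log ((n : ℝ) * (d : ℝ) / δ)) ≤ (m : ℝ) →
        ∃ E : Set (VAE.Params m d),
          MeasurableSet E ∧
          ENNReal.ofReal (1 - δ) ≤ VAE.initLaw σ₀ m d E ∧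
          ∀ θ₀ ∈ E,
            (∃ θ : ℝ → VAE.Params m d,
              VAE.IsGradientFlow (VAE.mseLoss σ ψ x xe) θ₀ θ) ∧
            ∀ θ : ℝ → VAE.Params m d,
              VAE.IsGradientFlow (VAE.mseLoss σ ψ x xe) θ₀ θ →
              ∀ t : ℝ, 0 ≤ t →
                VAE.mseLoss σ ψ x xe (θ t)
                  ≤ Real.exp (-(lam₀ / (n : ℝ)) * t) * VAE.mseLoss σ ψ x xe (θ 0) := by
  have h := VAE.isSmoothActivation_comp (hσ.differentiable (by norm_num)) hψ hσL hσβ hψL hψβ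
  set L₁ := L * L
  set β₁ := β * L * L + L * β
  set φ' := fun u => deriv ψ (σ u) * deriv σ u
  set G := VAE.gradMoment (fun u => ψ (σ u)) L₁ σ₀
  have hG : 0 ≤ G := VAE.gradMoment_nonneg _ _ _
  have hκ0 := VAE.gaussMoment4_nonneg
  have hU0 := VAE.unitMoment_nonneg (fun u => ψ (σ u)) L₁ σ₀
  -- The summands `1` make the constants positive, also when `ψ ∘ σ = 0` and `B = 0`.
  set K := (VAE.gaussMoment4 + VAE.unitMoment (fun u => ψ (σ u)) L₁ σ₀) / 2 + B ^ 2 + 1 with hK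
  set κ := VAE.gaussMoment4 + 1 with hκ
  have hKpos : 0 < K := by positivity
  have hκpos : 0 < κ := by positivity
  set C := 1 + (48 * G + 51840 * L₁ ^ 2 * K + (17280 * (L₁ * β₁)) ^ 2 * κ * K) * (1 + G) ^ 2
  have hC : 0 < C := by positivity
  refine ⟨C, hC, fun n d x xe hxe hx Θinf lam hΘ hleast hlam δ hδ hδ1 m hm => ?_⟩
  obtain ⟨p₀⟩ := hleast.nonempty
  have hn : 0 < n := p₀.1.pos
  have hd : 0 < d := p₀.2.pos
  have hn1 : (1 : ℝ) ≤ n := by exact_mod_cast hn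
  have hd1 : (1 : ℝ) ≤ d := by exact_mod_cast hd
  -- Chebyshev's inequality for the kernel entries costs a factor `1 / δ`, which the first term of
  -- the maximum already contains.
  have hwidth : C * ((n : ℝ) ^ 5 * (d : ℝ) ^ 3 / (lam ^ 4 * δ ^ 2)) ≤ m :=
    (mul_le_mul_of_nonneg_left (le_max_left _ _) hC.le).trans hm
  have hm0 : (0 : ℝ) < m := lt_of_lt_of_le (by positivity) hwidth
  have hmpos : 0 < m := by exact_mod_cast hm0
  have hsymm := hΘ.symm h hxe
  have hΛ : lam ≤ 1 + G := (hleast.le_diag hsymm p₀).trans (hΘ.diag_le h hxe p₀)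
  obtain ⟨hstable, hprob⟩ := VAE.width_bounds (b := L₁ * β₁) hn1 hd1 hm0 hKpos hκpos hlam hδ hδ1 hG
    hΛ (by linarith) hwidth
  set H := 3 * d * K / δ with hH
  set Q := 3 * m * (d : ℝ) ^ 2 * κ / δ with hQ
  have hHpos : 0 < H := by positivity
  have hQpos : 0 < Q := by positivity
  set Z := fun θ : VAE.Params m d => ∑ P : (Fin n × Fin d) × (Fin n × Fin d),
    (VAE.ntk σ ψ xe θ P.1 P.2 - Θinf P.1 P.2) ^ 2
  set μ := VAE.initLaw σ₀ m d
  set E : Set (VAE.Params m d) := {θ | H ≤ VAE.mseLoss σ ψ x xe θ}ᶜ ∩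
    ({θ | lam ^ 2 / 16 ≤ Z θ}ᶜ ∩ {θ | Q ≤ VAE.decoderMoment θ}ᶜ) with hE
  have hcloss : Continuous (VAE.mseLoss (m := m) σ ψ x xe) :=
    continuous_iff_continuousAt.2 fun θ => (VAE.hasGradientAt_mseLoss h x xe θ).continuousAt
  have hcZ : Continuous Z := by
    refine continuous_finsetSum _ fun P _ => ?_
    simp only [VAE.ntk_eq_inner h]
    exact (((VAE.locallyLipschitz_outputGrad h (hxe _) _).continuous.inner
      (VAE.locallyLipschitz_outputGrad h (hxe _) _).continuous).sub continuous_const).pow 2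
  have hcdec : Continuous fun θ : VAE.Params m d => VAE.decoderMoment θ := by
    unfold VAE.decoderMoment
    fun_prop
  have hmeas : MeasurableSet E :=
    ((isClosed_le continuous_const hcloss).measurableSet.compl).inter
      ((isClosed_le continuous_const hcZ).measurableSet.compl.inter
        (isClosed_le continuous_const hcdec).measurableSet.compl)
  refine ⟨E, hmeas, ?_, fun θ₀ hθ₀ => ?_⟩
  · have h1 : μ {θ | H ≤ VAE.mseLoss σ ψ x xe θ} ≤ ENNReal.ofReal (δ / 3) := by
      obtain ⟨hi, hb⟩ := VAE.mseLoss_integral h hxe hx σ₀ hmpos hn hd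
      refine (VAE.measure_ge_le_of_integral_le (fun θ => ?_) hi hb hHpos).trans
        (ENNReal.ofReal_le_ofReal ?_)
      · rw [VAE.mseLoss]; positivity
      · rw [div_le_iff₀ hHpos, hH, show δ / 3 * (3 * d * K / δ) = d * K by field_simp, hK]
        exact mul_le_mul_of_nonneg_left (by linarith) (by positivity)
    have h2 : μ {θ | lam ^ 2 / 16 ≤ Z θ} ≤ ENNReal.ofReal (δ / 3) := by
      obtain ⟨hi, hb⟩ := VAE.ntk_sq_distance h hxe hΘ hmpos
      exact (VAE.measure_ge_le_of_integral_le (fun θ => Finset.sum_nonneg fun P _ => sq_nonneg _)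
        hi hb (by positivity)).trans (ENNReal.ofReal_le_ofReal hprob)
    have h3 : μ {θ | Q ≤ VAE.decoderMoment θ} ≤ ENNReal.ofReal (δ / 3) := by
      obtain ⟨hi, hb⟩ := VAE.decoderMoment_integral σ₀ m d
      refine (VAE.measure_ge_le_of_integral_le (fun θ => ?_) hi hb hQpos).trans
        (ENNReal.ofReal_le_ofReal ?_)
      · rw [VAE.decoderMoment]; positivity
      · rw [div_le_iff₀ hQpos, hQ,
          show δ / 3 * (3 * m * (d : ℝ) ^ 2 * κ / δ) = m * (d ^ 2 * κ) by field_simp, hκ]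
        gcongr
        linarith
    have hcompl : μ Eᶜ ≤ ENNReal.ofReal δ := by
      rw [hE, Set.compl_inter, Set.compl_inter, compl_compl, compl_compl, compl_compl]
      calc _ ≤ ENNReal.ofReal (δ / 3) + (ENNReal.ofReal (δ / 3) + ENNReal.ofReal (δ / 3)) :=
            (measure_union_le _ _).trans
              (add_le_add h1 ((measure_union_le _ _).trans (add_le_add h2 h3)))
        _ = ENNReal.ofReal δ := by
            rw [← ENNReal.ofReal_add (by positivity) (by positivity),
              ← ENNReal.ofReal_add (by positivity) (by positivity)]
            congr 1; ring
    have hE1 : μ E = 1 - μ Eᶜ := by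
      rw [← prob_compl_eq_one_sub hmeas.compl, compl_compl]
    rw [hE1, ENNReal.ofReal_sub _ hδ.le, ENNReal.ofReal_one]
    exact tsub_le_tsub_left hcompl 1
  · simp only [hE, Set.mem_inter_iff, Set.mem_compl_iff, Set.mem_ofPred_eq, not_le] at hθ₀
    exact VAE.gradientFlow_converges h hxe hn hlam hHpos (hleast.mul_sum_sq_le hsymm) hθ₀.1.le
      hθ₀.2.1.le hθ₀.2.2.le hstable
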